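/- All polytopes and graphs are finite. An *abstract polytope* of rank $m$ is a finite poset with a least and a greatest element in which every maximal chain (*flag*) has exactly $m+2$ elements, which satisfies the diamond condition (if $F<G$ are faces whose ranks differ by $2$, there are exactly two faces $H$ with $F<H<G$), and which is strongly flag-connected (any two flags $\Phi,\Psi$ are joined by a sequence of successively adjacent flags in which only faces of ranks where $\Phi$ and $\Psi$ differ are changed). The *flag-graph* of a polytope of rank $m$ has the flags as vertices, two flags being joined by an edge of color $i\in\{0,\dots,m-1\}$ if they differ exactly in their faces of rank $i$. The *symmetry type graph* of a polytope is the quotient of its flag-graph by the group of color-preserving automorphisms of the flag-graph: its vertices are the flag orbits, two distinct orbits are joined by a link of color $i$ if some flag of one is $i$-adjacent to some flag of the other, and an orbit carries a semi-edge of color $i$ if it contains two $i$-adjacent flags. **Theorem 5.6.** Let $n\ge 2$ and let $\mathcal X=2^{n+1}_{[1,n-1]}$ be the premaniplex of rank $n+1$ with exactly two vertices in which the edges of colors $0$ and $n$ are links joining the two vertices, and in which each vertex has a semi-edge of color $i$ for every $i\in\{1,\dots,n-1\}$. Then there is a finite abstract polytope of rank $n+1$ whose symmetry type graph is isomorphic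 to $\mathcal X$ as an edge-colored graph. -/

import Mathlib

/-! ### Edge-coloured graphs with semi-edges -/

/-- A graph on the vertex set `V` whose edges are coloured with `0, …, n - 1`. `Adj i v w` with
`v ≠ w` says that a link of colour `i` joins `v` and `w`; `Adj i v v` says that there is a semi-edge
of colour `i` at `v`. -/
structure ColoredGraph (n : ℕ) (V : Type*) where
  Adj : Fin n → V → V → Prop
  symm : ∀ i v w, Adj i v w → Adj i w v

namespace ColoredGraph

/-- An isomorphism of edge-coloured graphs: a bijection of the vertices that preserves the edges
and their colours. -/
structure Iso {n : ℕ} {V W : Type*} (G : ColoredGraph n V) (H : ColoredGraph n W) where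
  toEquiv : V ≃ W
  adj_iff : ∀ i v w, H.Adj i (toEquiv v) (toEquiv w) ↔ G.Adj i v w

/-- Two vertices are equivalent if some automorphism of `G` maps one to the other; the classes are
the orbits of the automorphism group. -/
def orbitSetoid {n : ℕ} {V : Type*} (G : ColoredGraph n V) : Setoid V where
  r v w := ∃ σ : Iso G G, σ.toEquiv v = w
  iseqv :=
    { refl := fun v => ⟨⟨Equiv.refl V, fun _ _ _ => Iff.rfl⟩, rfl⟩
      symm := by
        rintro v w ⟨σ, rfl⟩
        refine ⟨⟨σ.toEquiv.symm, fun i a b => ?_⟩, by simp⟩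
        simpa using (σ.adj_iff i (σ.toEquiv.symm a) (σ.toEquiv.symm b)).symm
      trans := by
        rintro u v w ⟨σ, rfl⟩ ⟨τ, rfl⟩
        exact ⟨⟨σ.toEquiv.trans τ.toEquiv, fun i a b =>
          (τ.adj_iff i (σ.toEquiv a) (σ.toEquiv b)).trans (σ.adj_iff i a b)⟩, rfl⟩ }

/-- The symmetry type graph of `G`: its vertices are the orbits of the automorphism group of `G`,
and two orbits `x`, `y` are joined by an edge of colour `i` (a semi-edge if `x = y`) if and only if
some vertex of `x` is joined to some vertex of `y` by an edge of colour `i`. -/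
def symmetryTypeGraph {n : ℕ} {V : Type*} (G : ColoredGraph n V) :
    ColoredGraph n (Quotient G.orbitSetoid) where
  Adj i x y := ∃ v w : V, Quotient.mk G.orbitSetoid v = x ∧ Quotient.mk G.orbitSetoid w = y ∧
    G.Adj i v w
  symm := by
    rintro i x y ⟨v, w, hv, hw, h⟩
    exact ⟨w, v, hw, hv, G.symm i v w h⟩

/-- An `n`-premaniplex: a connected graph in which every vertex is incident to exactly one edge
(link or semi-edge) of each colour, and in which the alternating paths of length 4 in two
non-consecutive colours are closed. -/
structure IsPremaniplex {n : ℕ} {V : Type*} (G : ColoredGraph n V) : Prop where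
  nonempty : Nonempty V
  connected : ∀ v w, Relation.ReflTransGen (fun a b => ∃ i, G.Adj i a b) v w
  existsUnique_adj : ∀ i v, ∃! w, G.Adj i v w
  closed : ∀ i j : Fin n, (i : ℕ) + 1 < j ∨ (j : ℕ) + 1 < i → ∀ a b c d e,
    G.Adj i a b → G.Adj j b c → G.Adj i c d → G.Adj j d e → e = a

/-- The graph `2ⁿ_I` with two vertices: the colours in `I` are those of the semi-edges (one at each
vertex), and every colour not in `I` is the colour of a link between the two vertices. -/
def twoVertex (n : ℕ) (I : Set (Fin n)) : ColoredGraph n Bool where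
  Adj i v w := (i ∈ I ∧ v = w) ∨ (i ∉ I ∧ v ≠ w)
  symm := by
    rintro i v w (⟨h, e⟩ | ⟨h, e⟩)
    · exact Or.inl ⟨h, e.symm⟩
    · exact Or.inr ⟨h, e.symm⟩

/-- `2ⁿ_I` is a premaniplex whenever `I` is a proper subset of the set of colours. -/
theorem isPremaniplex_twoVertex (n : ℕ) (I : Set (Fin n)) (hI : I ≠ Set.univ) :
    (twoVertex n I).IsPremaniplex := by
  obtain ⟨k, hk⟩ := (Set.ne_univ_iff_exists_notMem I).1 hI
  refine ⟨⟨true⟩, fun v w => ?_, fun i v => ?_, ?_⟩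
  · by_cases h : v = w
    · subst h; exact Relation.ReflTransGen.refl
    · exact Relation.ReflTransGen.single ⟨k, Or.inr ⟨hk, h⟩⟩
  · by_cases h : i ∈ I
    · exact ⟨v, Or.inl ⟨h, rfl⟩, by rintro w (⟨_, e⟩ | ⟨h', _⟩); exacts [e.symm, absurd h h']⟩
    · refine ⟨!v, Or.inr ⟨h, by cases v <;> decide⟩, ?_⟩
      rintro w (⟨h', _⟩ | ⟨_, e⟩)
      · exact absurd h' h
      · revert e; cases v <;> cases w <;> decide
  · intro i j _ a b c d e h1 h2 h3 h4
    simp only [twoVertex] at h1 h2 h3 h4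
    by_cases hi : i ∈ I <;> by_cases hj : j ∈ I <;>
      simp only [hi, hj, true_and, not_true_eq_false, false_and, or_false, not_false_eq_true,
        false_or] at h1 h2 h3 h4 <;>
      revert a b c d e <;> decide

end ColoredGraph

/-! ### Abstract polytopes -/

section Polytope

variable (P : Type*) [PartialOrder P]

/-- A flagged poset of rank `n`: there are a least and a greatest element, and every flag (maximal
chain) has exactly `n + 2` elements. -/
def IsFlagged (n : ℕ) : Prop :=
  (∃ b : P, IsBot b) ∧ (∃ t : P, IsTop t) ∧ ∀ Φ : Flag P, (Φ : Set P).encard = n + 2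

variable {P}

/-- The rank of a face. In a flagged poset, all maximal chains among those with greatest element `F`
have the same size, which is `Order.height F + 1` and is to be `faceRank F + 2`; the least face
has rank `-1`. -/
noncomputable def faceRank (F : P) : ℤ :=
  ((Order.height F).toNat : ℤ) - 1

/-- The set consisting of the face of rank `i` of the flag `Φ`. -/
def Flag.faceAt (Φ : Flag P) (i : ℕ) : Set P :=
  {F | F ∈ Φ ∧ faceRank F = i}

/-- Two flags are `i`-adjacent if they have the same faces of ranks different from `i`, but
different faces of rank `i`. -/
def Flag.Adjacent (i : ℕ) (Φ Ψ : Flag P) : Prop :=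
  (∀ F : P, faceRank F ≠ i → (F ∈ Φ ↔ F ∈ Ψ)) ∧ Φ.faceAt i ≠ Ψ.faceAt i

variable (P)

/-- The diamond condition. -/
def DiamondCondition : Prop :=
  ∀ F G : P, F < G → faceRank G - faceRank F = 2 → {H : P | F < H ∧ H < G}.encard = 2

/-- Strong flag-connectedness: any two flags `Φ`, `Ψ` are joined by a sequence of successively
adjacent flags that only changes faces of ranks in which `Φ` and `Ψ` differ. -/
def StronglyFlagConnected : Prop :=
  ∀ Φ Ψ : Flag P, Relation.ReflTransGen
    (fun A B : Flag P => ∃ i : ℕ, Flag.Adjacent i A B ∧ Φ.faceAt i ≠ Ψ.faceAt i) Φ Ψ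

/-- An abstract polytope of rank `n`. -/
structure IsAbstractPolytope (n : ℕ) : Prop where
  flagged : IsFlagged P n
  diamond : DiamondCondition P
  connected : StronglyFlagConnected P

/-- The flag-graph of a (poset that is a) polytope of rank `n`: the vertices are the flags, and
`i`-adjacent flags are joined by an edge of colour `i`, for `0 ≤ i ≤ n - 1`. -/
def flagGraph (n : ℕ) : ColoredGraph n (Flag P) where
  Adj i Φ Ψ := Flag.Adjacent (i : ℕ) Φ Ψ
  symm := fun _ _ _ h => ⟨fun F hF => (h.1 F hF).symm, h.2.symm⟩

end Polytope

/-!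
In the polytope every vertex figure is the cross-polytope of dimension `n`. Let `t v` be involutions without fixed points on a finite set `X`, one for each
vertex `v` of the cross-polytope, which generate a transitive group. The pairs of a proper face
`S` of the cross-polytope and an orbit of the group generated by the `t v` with `v ∈ S`, together
with a least and a greatest element, always form an abstract polytope
(`FacePoset.isAbstractPolytope`), whatever the involutions are: the labels `S` keep faces with the
same vertices apart. Strong connectedness is reduced to the connectedness of open intervals
(`IsRankFunction.stronglyFlagConnected`). The flags are the pairs `(x, a)` of a point and a signed
permutation (`FacePoset.flagEquiv`): the `0`-adjacent flag is `(t (a e₁) x, a)`, and for `i ≥ 1`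
the `i`-adjacent one is `(x, a * gen i)` with the standard generators of the group of signed
permutations (`FacePoset.adjacent_flagOf_iff`).

Thus an automorphism of the flag graph is a signed permutation `g` together with a bijection `f`
of `X` such that `f (t v x) = t (g v) (f x)`. What is needed is a set `X` with a parity of points
which every `t v` changes, such that `(f, g)` with `f x = y` exists if and only if the parity of
`g` (the product of its signs) is the product of the parities of `x` and `y`. Then the flags fall
into two orbits according to the product of the parities of `x` and `a`; this type changes exactly
under the colors `0` (the point moves) and `n` (a sign changes).

Here `X` is the set of cosets of a subgroup of the free group on the vertices of the
cross-polytope. An auxiliary action of the free group is given by the involutions `crossing` on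
the pairs of a sign vector `x` and an element of `ℤ/11`; the subgroup `vertexSubgroup` consists of
the words whose images under even (odd) signed permutations fix all even (odd) points, which makes
the wanted automorphisms exist (`conj_twist_mem`). No others exist, by a word that lies in this
subgroup but moves an odd point (`chiralWord_mem`, `exists_chiralWord_ne`): the products of the
two involutions in direction `i` act over the sign vector `x` by affine maps with linear part
`4 ^ (x i)`, and since `4 - 4⁻¹ = 1` in `ℤ/11`, the map `m ↦ b m b⁻¹ (b⁻¹ m⁻¹ b)` for such a product
`b` multiplies translations `m` by `x i`. Composing these maps over all `i` multiplies a
translation by the parity of `x`, whatever the order of the directions, and hence fixes the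
translation at even points and inverts it at odd ones.
-/

/-! ### Ranked posets and their flags -/

/-- A rank function on a bounded poset: strictly monotone, from `0` at the least element to `N` at
the greatest one, and such that below or at any `b > a` there is an element of the next rank
above `a`. Ranks start at `0` here, so they are one more than `faceRank`. -/
structure IsRankFunction {P : Type*} [PartialOrder P] [BoundedOrder P] (rk : P → ℕ) (N : ℕ) :
    Prop where
  strictMono : StrictMono rk
  rk_bot : rk ⊥ = 0
  rk_top : rk ⊤ = N
  exists_next : ∀ a b : P, a < b → ∃ c, a < c ∧ c ≤ b ∧ rk c = rk a + 1

namespace IsRankFunction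

variable {P : Type*} [PartialOrder P] [BoundedOrder P] {rk : P → ℕ} {N : ℕ}

theorem rk_le (h : IsRankFunction rk N) (a : P) : rk a ≤ N :=
  h.rk_top ▸ h.strictMono.monotone le_top

theorem eq_of_rk_eq (h : IsRankFunction rk N) {Φ : Flag P} {a b : P} (ha : a ∈ Φ) (hb : b ∈ Φ)
    (hab : rk a = rk b) : a = b := by
  rcases Φ.le_or_le ha hb with hle | hle
  · rcases hle.eq_or_lt with e | hlt
    · exact e
    · exact absurd hab (h.strictMono hlt).ne
  · rcases hle.eq_or_lt with e | hlt
    · exact e.symm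
    · exact absurd hab (h.strictMono hlt).ne'

theorem le_of_rk_le (h : IsRankFunction rk N) {Φ : Flag P} {a b : P} (ha : a ∈ Φ) (hb : b ∈ Φ)
    (hab : rk a ≤ rk b) : a ≤ b := by
  rcases Φ.le_or_le ha hb with hle | hle
  · exact hle
  · exact (h.eq_of_rk_eq hb ha (le_antisymm (h.strictMono.monotone hle) hab)).ge

theorem exists_mem_flag (h : IsRankFunction rk N) (Φ : Flag P) {k : ℕ} (hk : k ≤ N) :
    ∃ a ∈ Φ, rk a = k := by
  induction k with
  | zero => exact ⟨⊥, Φ.bot_mem, h.rk_bot⟩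
  | succ k ih =>
    obtain ⟨a, ha, hak⟩ := ih (by omega)
    -- `b` is an element of least rank among the members of the flag of rank above `k`
    have hex : ∃ m, ∃ b ∈ Φ, k < rk b ∧ rk b = m :=
      ⟨N, ⊤, Φ.top_mem, by rw [h.rk_top]; omega, h.rk_top⟩
    classical
    obtain ⟨b, hb, hkb, hbm⟩ := Nat.find_spec hex
    have hab : a < b := lt_of_le_of_ne (h.le_of_rk_le ha hb (by omega)) (by rintro rfl; omega)
    obtain ⟨c, hac, hcb, hc⟩ := h.exists_next a b hab
    refine ⟨c, Flag.mem_iff_forall_le_or_ge.2 fun d hd => ?_, by omega⟩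
    by_cases hdk : k < rk d
    · left
      refine hcb.trans (h.le_of_rk_le hb hd ?_)
      rw [hbm]
      exact Nat.find_min' hex ⟨d, hd, hdk, rfl⟩
    · right
      exact (h.le_of_rk_le hd ha (by omega)).trans hac.le

/-- The element of rank `k` of a flag (the greatest element if `k` exceeds the maximal rank). -/
noncomputable def face (h : IsRankFunction rk N) (Φ : Flag P) (k : ℕ) : P :=
  if hk : k ≤ N then (h.exists_mem_flag Φ hk).choose else ⊤

theorem face_mem (h : IsRankFunction rk N) (Φ : Flag P) (k : ℕ) : h.face Φ k ∈ Φ := by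
  unfold face
  split_ifs with hk
  · exact (h.exists_mem_flag Φ hk).choose_spec.1
  · exact Φ.top_mem

theorem rk_face (h : IsRankFunction rk N)
    (Φ : Flag P) {k : ℕ} (hk : k ≤ N) : rk (h.face Φ k) = k := by
  unfold face
  rw [dif_pos hk]
  exact (h.exists_mem_flag Φ hk).choose_spec.2

theorem face_rk (h : IsRankFunction rk N) {Φ : Flag P} {a : P} (ha : a ∈ Φ) : h.face Φ (rk a) = a :=
  h.eq_of_rk_eq (h.face_mem Φ _) ha (h.rk_face Φ (h.rk_le a))

theorem face_eq (h : IsRankFunction rk N)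
    {Φ : Flag P} {a : P} {k : ℕ} (ha : a ∈ Φ) (hk : rk a = k) : h.face Φ k = a :=
  hk ▸ h.face_rk ha

theorem face_zero (h : IsRankFunction rk N)
    (Φ : Flag P) : h.face Φ 0 = ⊥ := h.face_eq Φ.bot_mem h.rk_bot

theorem face_top (h : IsRankFunction rk N)
    (Φ : Flag P) : h.face Φ N = ⊤ := h.face_eq Φ.top_mem h.rk_top

theorem face_le (h : IsRankFunction rk N) (Φ : Flag P) {k l : ℕ} (hl : l ≤ N) (hkl : k ≤ l) :
    h.face Φ k ≤ h.face Φ l :=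
  h.le_of_rk_le (h.face_mem Φ k) (h.face_mem Φ l) (by
    rw [h.rk_face Φ hl, h.rk_face Φ (hkl.trans hl)]; exact hkl)

theorem face_lt (h : IsRankFunction rk N) (Φ : Flag P) {k l : ℕ} (hl : l ≤ N) (hkl : k < l) :
    h.face Φ k < h.face Φ l :=
  lt_of_le_of_ne (h.face_le Φ hl hkl.le) fun e => by
    have := congrArg rk e
    rw [h.rk_face Φ hl, h.rk_face Φ (hkl.le.trans hl)] at this
    omega

theorem flag_ext (h : IsRankFunction rk N)
    {Φ Ψ : Flag P} (hf : ∀ k ≤ N, h.face Φ k = h.face Ψ k) : Φ = Ψ := by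
  refine SetLike.ext fun a => ⟨fun ha => ?_, fun ha => ?_⟩
  · rw [← h.face_rk ha, hf _ (h.rk_le a)]; exact h.face_mem Ψ _
  · rw [← h.face_rk ha, ← hf _ (h.rk_le a)]; exact h.face_mem Φ _

theorem encard_flag (h : IsRankFunction rk N) (Φ : Flag P) : (Φ : Set P).encard = N + 1 := by
  have hinj : Function.Injective (fun k : Fin (N + 1) => h.face Φ k) := fun k l hkl => by
    have := congrArg rk hkl
    simp only [h.rk_face Φ (Nat.lt_succ_iff.1 k.2), h.rk_face Φ (Nat.lt_succ_iff.1 l.2)] at this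
    exact Fin.ext this
  have hrange : (Φ : Set P) = Set.range (fun k : Fin (N + 1) => h.face Φ k) := by
    ext a
    refine ⟨fun ha => ⟨⟨rk a, Nat.lt_succ_of_le (h.rk_le a)⟩, h.face_rk ha⟩, ?_⟩
    rintro ⟨k, rfl⟩
    exact h.face_mem Φ k
  rw [hrange, ← Set.image_univ, hinj.encard_image, Set.encard_univ]
  simp

theorem height_eq (h : IsRankFunction rk N) (a : P) : Order.height a = rk a := by
  refine le_antisymm ?_ ?_
  · refine (Order.height_le_height_apply_of_strictMono rk h.strictMono a).trans ?_
    rw [Order.height_nat]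
  · generalize hk : rk a = k
    induction k generalizing a with
    | zero => simp
    | succ k ih =>
      obtain ⟨Φ, haΦ⟩ := IsChain.exists_subset_flag (IsChain.singleton (r := (· ≤ ·)) (a := a))
      have haΦ : a ∈ Φ := haΦ rfl
      have hN := h.rk_le a
      have hlt : h.face Φ k < a := by
        have := h.face_lt Φ (k := k) (l := k + 1) (by omega) (by omega)
        rwa [h.face_eq haΦ hk] at this
      have := Order.height_add_one_le hlt
      refine le_trans ?_ this
      push_cast
      gcongr
      exact ih _ (h.rk_face Φ (by omega))

theorem faceRank_eq (h : IsRankFunction rk N) (a : P) : faceRank a = (rk a : ℤ) - 1 := by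
  simp [faceRank, h.height_eq a]

theorem faceAt_eq (h : IsRankFunction rk N) (Φ : Flag P) {i : ℕ} (hi : i + 1 ≤ N) :
    Φ.faceAt i = {h.face Φ (i + 1)} := by
  ext a
  simp only [Flag.faceAt, Set.mem_ofPred_eq, Set.mem_singleton_iff, h.faceRank_eq]
  constructor
  · rintro ⟨ha, e⟩
    exact (h.face_eq ha (by omega)).symm
  · rintro rfl
    exact ⟨h.face_mem Φ _, by rw [h.rk_face Φ hi]; push_cast; ring⟩

theorem faceAt_ne_iff (h : IsRankFunction rk N) (Φ Ψ : Flag P) {i : ℕ} (hi : i + 1 ≤ N) :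
    Φ.faceAt i ≠ Ψ.faceAt i ↔ h.face Φ (i + 1) ≠ h.face Ψ (i + 1) := by
  rw [h.faceAt_eq Φ hi, h.faceAt_eq Ψ hi, ne_eq, Set.singleton_eq_singleton_iff]

/-- Beyond the maximal rank the flags have no faces, so in ranks above it no two flags differ. -/
theorem le_of_faceAt_ne (h : IsRankFunction rk N)
    {Φ Ψ : Flag P} {i : ℕ} (hi : Φ.faceAt i ≠ Ψ.faceAt i) : i + 1 < N := by
  by_contra hN
  rcases (not_lt.1 hN).eq_or_lt with e | hlt
  · exact hi (by rw [h.faceAt_eq Φ e.ge, h.faceAt_eq Ψ e.ge, ← e, h.face_top, h.face_top])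
  · refine hi ?_
    have key : ∀ Φ : Flag P, Φ.faceAt i = ∅ := fun Φ => by
      ext a
      simp only [Flag.faceAt, Set.mem_ofPred_eq, Set.mem_empty_iff_false, iff_false, not_and,
        h.faceRank_eq]
      intro _ e
      have := h.rk_le a
      omega
    rw [key, key]

theorem adjacent_iff (h : IsRankFunction rk N) (Φ Ψ : Flag P) {i : ℕ} (hi : i + 1 ≤ N) :
    Flag.Adjacent i Φ Ψ ↔ (∀ k ≤ N, k ≠ i + 1 → h.face Φ k = h.face Ψ k) ∧
      h.face Φ (i + 1) ≠ h.face Ψ (i + 1) := by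
  unfold Flag.Adjacent
  rw [h.faceAt_ne_iff Φ Ψ hi]
  refine and_congr_left fun _ => ⟨fun hf k hk hki => ?_, fun hf F hF => ?_⟩
  · refine (h.face_eq ((hf _ ?_).2 (h.face_mem Ψ k)) (h.rk_face Ψ hk))
    rw [h.faceRank_eq, h.rk_face Ψ hk]
    omega
  · rw [h.faceRank_eq] at hF
    have hk : rk F ≠ i + 1 := by omega
    have e := hf _ (h.rk_le F) hk
    constructor
    · intro hm
      rw [← h.face_rk hm, e]
      exact h.face_mem Ψ _
    · intro hm
      rw [← h.face_rk hm, ← e]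
      exact h.face_mem Φ _

theorem isFlagged (h : IsRankFunction rk N) {n : ℕ} (hN : N = n + 1) : IsFlagged P n := by
  refine ⟨⟨⊥, isBot_bot⟩, ⟨⊤, isTop_top⟩, fun Φ => ?_⟩
  rw [h.encard_flag, hN]
  push_cast
  rw [add_assoc]
  norm_num

/-- The diamond condition makes `i`-adjacent flags unique. -/
theorem adjacent_unique (h : IsRankFunction rk N)
    (hd : DiamondCondition P) {Φ Ψ Ψ' : Flag P} {i : ℕ} (hi : i + 1 < N)
    (h1 : Flag.Adjacent i Φ Ψ) (h2 : Flag.Adjacent i Φ Ψ') : Ψ = Ψ' := by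
  rw [h.adjacent_iff _ _ hi.le] at h1 h2
  refine h.flag_ext fun k hk => ?_
  by_cases hki : k = i + 1
  · subst hki
    have h3 := hd (h.face Φ i) (h.face Φ (i + 2)) (h.face_lt Φ (by omega) (by omega)) (by
      rw [h.faceRank_eq, h.faceRank_eq, h.rk_face Φ (by omega), h.rk_face Φ (by omega)]
      push_cast; ring)
    obtain ⟨x, y, hxy, e⟩ := Set.encard_eq_two.1 h3
    have m0 : h.face Φ (i + 1) ∈ ({x, y} : Set P) := by
      rw [← e]; exact ⟨h.face_lt Φ (by omega) (by omega), h.face_lt Φ (by omega) (by omega)⟩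
    have m1 : h.face Ψ (i + 1) ∈ ({x, y} : Set P) := by
      rw [← e, h1.1 i (by omega) (by omega), h1.1 (i + 2) (by omega) (by omega)]
      exact ⟨h.face_lt Ψ (by omega) (by omega), h.face_lt Ψ (by omega) (by omega)⟩
    have m2 : h.face Ψ' (i + 1) ∈ ({x, y} : Set P) := by
      rw [← e, h2.1 i (by omega) (by omega), h2.1 (i + 2) (by omega) (by omega)]
      exact ⟨h.face_lt Ψ' (by omega) (by omega), h.face_lt Ψ' (by omega) (by omega)⟩
    have n1 := h1.2
    have n2 := h2.2
    simp only [Set.mem_insert_iff, Set.mem_singleton_iff] at m0 m1 m2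
    rcases m0 with m0 | m0 <;> rcases m1 with m1 | m1 <;> rcases m2 with m2 | m2 <;>
      simp_all
  · rw [← h1.1 k hk hki, h2.1 k hk hki]

/-- The flag whose faces are the terms of a sequence of elements of ranks `0, …, N`. -/
def flagOfSeq (h : IsRankFunction rk N)
    (f : ℕ → P) (hf : ∀ k ≤ N, rk (f k) = k) (hmono : ∀ k l, k ≤ l → f k ≤ f l) :
    Flag P where
  carrier := f '' Set.Iic N
  Chain' := by
    rintro _ ⟨k, _, rfl⟩ _ ⟨l, _, rfl⟩ _
    exact (le_total k l).imp (hmono k l) (hmono l k)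
  max_chain' := fun s hs hsub => by
    refine Set.Subset.antisymm hsub fun a ha => ?_
    refine ⟨rk a, h.rk_le a, ?_⟩
    have hm : f (rk a) ∈ s := hsub ⟨rk a, h.rk_le a, rfl⟩
    have hr := hf _ (h.rk_le a)
    rcases hs.total ha hm with hle | hle
    · rcases hle.eq_or_lt with e | hlt
      · exact e.symm
      · exact absurd hr (h.strictMono hlt).ne'
    · rcases hle.eq_or_lt with e | hlt
      · exact e
      · exact absurd hr (h.strictMono hlt).ne

theorem face_flagOfSeq (h : IsRankFunction rk N) (f : ℕ → P) (hf : ∀ k ≤ N, rk (f k) = k)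
    (hmono : ∀ k l, k ≤ l → f k ≤ f l) {k : ℕ} (hk : k ≤ N) :
    h.face (h.flagOfSeq f hf hmono) k = f k :=
  h.face_eq ⟨k, hk, rfl⟩ (hf k hk)

/-- The part of a flag between its elements of ranks `i` and `j` can be replaced by a flag of that
interval through any two given comparable elements. -/
theorem exists_flag_through (h : IsRankFunction rk N)
    (Φ : Flag P) {i j : ℕ} (hij : i ≤ j) (hj : j ≤ N) {a b : P}
    (hab : a ≤ b ∨ b ≤ a) (ha : h.face Φ i < a ∧ a < h.face Φ j)
    (hb : h.face Φ i < b ∧ b < h.face Φ j) :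
    ∃ Ψ : Flag P, a ∈ Ψ ∧ b ∈ Ψ ∧ ∀ k ≤ N, k ≤ i ∨ j ≤ k → h.face Ψ k = h.face Φ k := by
  have hcomp : ∀ c : P, h.face Φ i < c ∧ c < h.face Φ j → ∀ k ≤ N, k ≤ i ∨ j ≤ k →
      h.face Φ k ≤ c ∨ c ≤ h.face Φ k := by
    rintro c hc k hk (hki | hjk)
    · exact Or.inl ((h.face_le Φ (hij.trans hj) hki).trans hc.1.le)
    · exact Or.inr (hc.2.le.trans (h.face_le Φ hk hjk))
  have hchain : IsChain (· ≤ ·)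
      (insert a (insert b {c | ∃ k ≤ N, (k ≤ i ∨ j ≤ k) ∧ h.face Φ k = c})) := by
    refine IsChain.insert (IsChain.insert ?_ ?_) ?_
    · rintro _ ⟨k, _, _, rfl⟩ _ ⟨l, _, _, rfl⟩ _
      exact Φ.le_or_le (h.face_mem Φ k) (h.face_mem Φ l)
    · rintro _ ⟨k, hk, hk', rfl⟩ _
      exact (hcomp b hb k hk hk').symm
    · rintro c (rfl | ⟨k, hk, hk', rfl⟩) _
      · exact hab
      · exact (hcomp a ha k hk hk').symm
  obtain ⟨Ψ, hΨ⟩ := hchain.exists_subset_flag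
  refine ⟨Ψ, hΨ (Or.inl rfl), hΨ (Or.inr (Or.inl rfl)), fun k hk hk' => ?_⟩
  exact h.face_eq (hΨ (Or.inr (Or.inr ⟨k, hk, hk', rfl⟩))) (h.rk_face Φ hk)

/-- The ranks in which two flags differ. -/
noncomputable def diff (h : IsRankFunction rk N) (Φ Ψ : Flag P) : Finset ℕ := by
  classical exact (Finset.range (N + 1)).filter fun k => h.face Φ k ≠ h.face Ψ k

theorem mem_diff (h : IsRankFunction rk N) {Φ Ψ : Flag P} {k : ℕ} :
    k ∈ h.diff Φ Ψ ↔ k ≤ N ∧ h.face Φ k ≠ h.face Ψ k := by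
  simp [diff]

/-- Two distinct ranks enclosing `k` at which the flags agree, while they differ strictly in
between. -/
theorem exists_block (h : IsRankFunction rk N) {Φ Ψ : Flag P} {k : ℕ} (hk : k ∈ h.diff Φ Ψ) :
    ∃ i j, i < k ∧ k < j ∧ j ≤ N ∧ h.face Φ i = h.face Ψ i ∧ h.face Φ j = h.face Ψ j ∧
      ∀ l, i < l → l < j → l ∈ h.diff Φ Ψ := by
  classical
  obtain ⟨hkN, hne⟩ := h.mem_diff.1 hk
  have hex : ∃ j, k ≤ j ∧ h.face Φ j = h.face Ψ j := ⟨N, hkN, by rw [h.face_top, h.face_top]⟩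
  obtain ⟨hkj, hj⟩ := Nat.find_spec hex
  have hjN : Nat.find hex ≤ N := Nat.find_min' hex ⟨hkN, by rw [h.face_top, h.face_top]⟩
  let p : ℕ → Prop := fun i => h.face Φ i = h.face Ψ i
  have hp0 : p 0 := by simp only [p, h.face_zero]
  have hi : p (Nat.findGreatest p k) := Nat.findGreatest_spec (Nat.zero_le k) hp0
  have hik : Nat.findGreatest p k ≤ k := Nat.findGreatest_le k
  refine ⟨Nat.findGreatest p k, Nat.find hex, lt_of_le_of_ne hik ?_, lt_of_le_of_ne hkj ?_, hjN,
    hi, hj, fun l hl hl' => h.mem_diff.2 ⟨by omega, fun e => ?_⟩⟩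
  · intro e
    rw [e] at hi
    exact hne hi
  · intro e
    rw [← e] at hj
    exact hne hj
  · rcases le_total l k with hlk | hlk
    · exact Nat.findGreatest_is_greatest hl hlk e
    · exact Nat.find_min hex hl' ⟨hlk, e⟩

/-- A ranked poset is strongly flag-connected if its open intervals of rank at least two are
connected by comparabilities. The induction is on the number of ranks in which two flags differ:
a path of comparabilities in an interval lifts to a sequence of flags through consecutive
members of the path, and any two consecutive flags share a further element. -/
theorem stronglyFlagConnected (h : IsRankFunction rk N)
    (hconn : ∀ F G : P, rk F + 3 ≤ rk G → ∀ a b : P, F < a → a < G → F < b → b < G →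
      Relation.ReflTransGen (fun x y => (x ≤ y ∨ y ≤ x) ∧ F < y ∧ y < G) a b) :
    StronglyFlagConnected P := by
  have key : ∀ m : ℕ, ∀ Φ Ψ : Flag P, (h.diff Φ Ψ).card ≤ m →
      Relation.ReflTransGen (fun A B => ∃ i, Flag.Adjacent i A B ∧ i + 1 ∈ h.diff Φ Ψ) Φ Ψ := by
    intro m
    induction m with
    | zero =>
      intro Φ Ψ hc
      have he : h.diff Φ Ψ = ∅ := Finset.card_eq_zero.1 (Nat.le_zero.1 hc)
      have : Φ = Ψ := h.flag_ext fun k hk => by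
        by_contra hne
        have : k ∈ h.diff Φ Ψ := h.mem_diff.2 ⟨hk, hne⟩
        simp [he] at this
      rw [this]
    | succ m ih =>
      intro Φ Ψ hc
      -- the induction hypothesis, for flags that differ in a smaller set of ranks
      have step : ∀ A B : Flag P, h.diff A B ⊂ h.diff Φ Ψ → Relation.ReflTransGen
          (fun A B => ∃ i, Flag.Adjacent i A B ∧ i + 1 ∈ h.diff Φ Ψ) A B := fun A B hAB => by
        refine Relation.ReflTransGen.mono ?_ _ _ (ih A B ?_)
        · rintro C D ⟨i, hi, hi'⟩
          exact ⟨i, hi, hAB.1 hi'⟩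
        · have := Finset.card_lt_card hAB
          omega
      rcases (h.diff Φ Ψ).eq_empty_or_nonempty with he | ⟨k, hk⟩
      · have : Φ = Ψ := h.flag_ext fun k hk => by
          by_contra hne
          have : k ∈ h.diff Φ Ψ := h.mem_diff.2 ⟨hk, hne⟩
          simp [he] at this
        rw [this]
      obtain ⟨i, j, hik, hkj, hjN, hi, hj, hblock⟩ := h.exists_block hk
      have hkN : k ≤ N := (h.mem_diff.1 hk).1
      -- flags which agree with `Φ` outside the block and share a member of the block
      have share : ∀ (A B : Flag P) (a : P), a ∈ A → a ∈ B → h.face Φ i < a → a < h.face Φ j →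
          (∀ l ≤ N, l ≤ i ∨ j ≤ l → h.face A l = h.face Φ l) →
          (∀ l ≤ N, l ≤ i ∨ j ≤ l → h.face B l = h.face Φ l) → h.diff A B ⊂ h.diff Φ Ψ := by
        intro A B a haA haB hia haj hA hB
        have hra : i < rk a ∧ rk a < j := by
          have h1 := h.strictMono hia
          have h2 := h.strictMono haj
          rw [h.rk_face Φ (by omega)] at h1 h2
          exact ⟨h1, h2⟩
        refine (Finset.ssubset_iff_of_subset fun l hl => ?_).2
          ⟨rk a, hblock _ hra.1 hra.2, fun hm => ?_⟩
        · obtain ⟨hlN, hne⟩ := h.mem_diff.1 hl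
          by_cases hl' : l ≤ i ∨ j ≤ l
          · exact absurd ((hA l hlN hl').trans (hB l hlN hl').symm) hne
          · exact hblock l (by omega) (by omega)
        · exact (h.mem_diff.1 hm).2 (by rw [h.face_rk haA, h.face_rk haB])
      have hgoal : ∃ A : Flag P, Relation.ReflTransGen
          (fun A B => ∃ i, Flag.Adjacent i A B ∧ i + 1 ∈ h.diff Φ Ψ) Φ A ∧
          h.face Ψ k ∈ A ∧ ∀ l ≤ N, l ≤ i ∨ j ≤ l → h.face A l = h.face Φ l := by
        have hΨk : h.face Φ i < h.face Ψ k ∧ h.face Ψ k < h.face Φ j := by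
          rw [hi, hj]
          exact ⟨h.face_lt Ψ hkN hik, h.face_lt Ψ hjN hkj⟩
        by_cases hsmall : j = i + 2
        · obtain ⟨A, hA, -, hA'⟩ := h.exists_flag_through Φ (by omega) hjN (Or.inl le_rfl) hΨk hΨk
          refine ⟨A, Relation.ReflTransGen.single ⟨k - 1, ?_, ?_⟩, hA, hA'⟩
          · rw [h.adjacent_iff _ _ (by omega)]
            have hk1 : k - 1 + 1 = k := by omega
            rw [hk1]
            refine ⟨fun l hl hlk => (hA' l hl (by omega)).symm, ?_⟩
            rw [h.face_eq hA (h.rk_face Ψ hkN)]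
            exact (h.mem_diff.1 hk).2
          · rwa [show k - 1 + 1 = k by omega]
        · have hpath := hconn (h.face Φ i) (h.face Φ j) (by
            rw [h.rk_face Φ hjN, h.rk_face Φ (by omega)]; omega) (h.face Φ k) (h.face Ψ k)
            (h.face_lt Φ hkN hik) (h.face_lt Φ hjN hkj) hΨk.1 hΨk.2
          suffices hs : ∀ b, Relation.ReflTransGen (fun x y => (x ≤ y ∨ y ≤ x) ∧
              h.face Φ i < y ∧ y < h.face Φ j) (h.face Φ k) b →
              (h.face Φ i < b ∧ b < h.face Φ j) ∧ ∃ A : Flag P, Relation.ReflTransGen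
              (fun A B => ∃ i, Flag.Adjacent i A B ∧ i + 1 ∈ h.diff Φ Ψ) Φ A ∧
              b ∈ A ∧ ∀ l ≤ N, l ≤ i ∨ j ≤ l → h.face A l = h.face Φ l from (hs _ hpath).2
          intro b hb
          induction hb with
          | refl =>
            exact ⟨⟨h.face_lt Φ hkN hik, h.face_lt Φ hjN hkj⟩, Φ, Relation.ReflTransGen.refl,
              h.face_mem Φ k, fun _ _ _ => rfl⟩
          | tail _ hbc ihb =>
            obtain ⟨hb, A, hΦA, hbA, hA⟩ := ihb
            obtain ⟨B, hbB, hcB, hB⟩ := h.exists_flag_through Φ (by omega) hjN hbc.1 hb hbc.2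
            exact ⟨hbc.2, B, hΦA.trans (step A B (share A B _ hbA hbB hb.1 hb.2 hA hB)), hcB, hB⟩
      obtain ⟨A, hΦA, hmA, hA⟩ := hgoal
      refine hΦA.trans (step A Ψ ((Finset.ssubset_iff_of_subset fun l hl => ?_).2
          ⟨k, hk, fun hm => ?_⟩))
      · obtain ⟨hlN, hne⟩ := h.mem_diff.1 hl
        by_cases hl' : l ≤ i ∨ j ≤ l
        · rw [hA l hlN hl'] at hne
          exact h.mem_diff.2 ⟨hlN, hne⟩
        · exact hblock l (by omega) (by omega)
      · exact (h.mem_diff.1 hm).2 (h.face_eq hmA (h.rk_face Ψ hkN))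
  intro Φ Ψ
  refine Relation.ReflTransGen.mono ?_ _ _ (key _ Φ Ψ le_rfl)
  rintro A B ⟨i, hi, hi'⟩
  obtain ⟨hiN, hne⟩ := h.mem_diff.1 hi'
  exact ⟨i, hi, (h.faceAt_ne_iff Φ Ψ hiN).2 hne⟩

end IsRankFunction

/-! ### Orbits of a family of involutions -/

/-- The vertices of the cross-polytope of dimension `n`: the pair `(i, s)` stands for the vertex
`s • eᵢ`. -/
abbrev SignedIndex (n : ℕ) := Fin n × ℤˣ

section Orbits

variable {V X : Type} (t : V → X → X)

/-- The points that can be reached from `x` by maps `t v` with `v ∈ S`. If all `t v` are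
involutions, this is an orbit of the group generated by them. -/
def orb (S : Finset V) (x : X) : Set X :=
  {y | Relation.ReflTransGen (fun a b => ∃ v ∈ S, b = t v a) x y}

theorem mem_orb_self (S : Finset V) (x : X) : x ∈ orb t S x := Relation.ReflTransGen.refl

theorem orb_trans {S : Finset V} {x y z : X} (hxy : y ∈ orb t S x) (hyz : z ∈ orb t S y) :
    z ∈ orb t S x :=
  Relation.ReflTransGen.trans hxy hyz

theorem orb_mono {S T : Finset V} (hST : S ⊆ T) (x : X) : orb t S x ⊆ orb t T x :=
  fun _ hy => Relation.ReflTransGen.mono (fun _ _ ⟨v, hv, e⟩ => ⟨v, hST hv, e⟩) _ _ hy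

theorem apply_mem_orb {S : Finset V} {v : V} (hv : v ∈ S) (x : X) : t v x ∈ orb t S x :=
  Relation.ReflTransGen.single ⟨v, hv, rfl⟩

theorem orb_empty (x : X) : orb t ∅ x = {x} := by
  ext y
  refine ⟨fun hy => ?_, fun hy => hy ▸ mem_orb_self t ∅ x⟩
  rcases Relation.ReflTransGen.cases_head hy with e | ⟨_, ⟨v, hv, _⟩, _⟩
  · exact e.symm
  · simp at hv

variable {t}

theorem orb_symm (hinv : ∀ v x, t v (t v x) = x) {S : Finset V} {x y : X}
    (hxy : y ∈ orb t S x) : x ∈ orb t S y := by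
  induction hxy with
  | refl => exact mem_orb_self t S x
  | tail _ hbc ih =>
    obtain ⟨v, hv, rfl⟩ := hbc
    refine orb_trans t (Relation.ReflTransGen.single ⟨v, hv, ?_⟩) ih
    exact (hinv v _).symm

theorem orb_eq_of_mem (hinv : ∀ v x, t v (t v x) = x) {S : Finset V} {x y : X}
    (hxy : y ∈ orb t S x) : orb t S y = orb t S x :=
  Set.Subset.antisymm (fun _ hz => orb_trans t hxy hz)
    (fun _ hz => orb_trans t (orb_symm hinv hxy) hz)

theorem orb_singleton (hinv : ∀ v x, t v (t v x) = x) (v : V) (x : X) :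
    orb t {v} x = {x, t v x} := by
  ext y
  refine ⟨fun hy => ?_, ?_⟩
  · induction hy with
    | refl => exact Or.inl rfl
    | tail _ hbc ih =>
      obtain ⟨w, hw, rfl⟩ := hbc
      rw [Finset.mem_singleton] at hw
      subst hw
      rcases ih with rfl | rfl
      · exact Or.inr rfl
      · exact Or.inl (hinv _ _)
  · rintro (rfl | rfl)
    · exact mem_orb_self t _ _
    · exact apply_mem_orb t (Finset.mem_singleton_self v) x

end Orbits

/-! ### The polytope of a family of involutions -/

/-- A family of involutions without fixed points, indexed by the vertices of the cross-polytope,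
that generates a transitive group on a nonempty set. -/
structure IsEdgeSystem {n : ℕ} {X : Type} (t : SignedIndex n → X → X) : Prop where
  nonempty : Nonempty X
  involutive : ∀ v x, t v (t v x) = x
  ne_self : ∀ v x, t v x ≠ x
  transitive : ∀ x y, y ∈ orb t Finset.univ x

/-- A proper face of the cross-polytope, given by its set of vertices: it has no two antipodal
vertices. -/
def IsCrossFace {n : ℕ} (S : Finset (SignedIndex n)) : Prop :=
  Set.InjOn Prod.fst (S : Set (SignedIndex n))

namespace IsCrossFace

variable {n : ℕ} {S T : Finset (SignedIndex n)}

theorem empty : IsCrossFace (∅ : Finset (SignedIndex n)) := by simp [IsCrossFace]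

theorem mono (hT : IsCrossFace T) (hST : S ⊆ T) : IsCrossFace S :=
  Set.InjOn.mono (by exact_mod_cast hST) hT

theorem card_le (hS : IsCrossFace S) : S.card ≤ n := by
  rw [← Finset.card_image_of_injOn hS]
  exact (Finset.card_le_univ _).trans (by simp)

theorem insert (hS : IsCrossFace S) {v : SignedIndex n} (hv : ∀ w ∈ S, w.1 ≠ v.1) :
    IsCrossFace (insert v S) := by
  intro a ha b hb hab
  simp only [Finset.coe_insert, Set.mem_insert_iff, Finset.mem_coe] at ha hb
  rcases ha with rfl | ha <;> rcases hb with rfl | hb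
  · rfl
  · exact absurd hab.symm (hv b hb)
  · exact absurd hab (hv a ha)
  · exact hS ha hb hab

theorem singleton (v : SignedIndex n) : IsCrossFace {v} := by simp [IsCrossFace]

theorem exists_fresh (hS : IsCrossFace S) (hc : S.card < n) : ∃ i, ∀ w ∈ S, w.1 ≠ i := by
  by_contra! hcon
  have : S.image Prod.fst = Finset.univ := by
    ext i
    obtain ⟨w, hw, e⟩ := hcon i
    simp only [Finset.mem_image, Finset.mem_univ, iff_true]
    exact ⟨w, hw, e⟩
  have h2 := Finset.card_image_of_injOn hS
  rw [this] at h2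
  simp at h2
  omega

theorem fst_ne {v : SignedIndex n} (hS : IsCrossFace (Insert.insert v S)) (hv : v ∉ S) :
    ∀ w ∈ S, w.1 ≠ v.1 := fun w hw e => by
  have := hS (by simp [hw]) (by simp) e
  exact hv (this ▸ hw)

end IsCrossFace

/-- The faces of the polytope other than the least and the greatest one: the face with label `S` at
the point `x` is the pair of the set `S` and the orbit of `x` under the maps `t v` with
`v ∈ S`. -/
abbrev ProperFace {n : ℕ} {X : Type} (t : SignedIndex n → X → X) :=
  {p : Finset (SignedIndex n) × Set X // IsCrossFace p.1 ∧ ∃ x, p.2 = orb t p.1 x}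

/-- The polytope of a family of involutions `t` on `X`: its vertices are the points of `X`, and
every vertex figure is the cross-polytope. -/
abbrev FacePoset {n : ℕ} {X : Type} (t : SignedIndex n → X → X) := WithBot (WithTop (ProperFace t))

namespace FacePoset

variable {n : ℕ} {X : Type} {t : SignedIndex n → X → X}

variable (t) in
/-- The face with label `S` at the point `x`. -/
def mk (S : Finset (SignedIndex n)) (hS : IsCrossFace S) (x : X) : FacePoset t :=
  WithBot.some (WithTop.some ⟨(S, orb t S x), hS, x, rfl⟩)

theorem cases_face (a : FacePoset t) : a = ⊥ ∨ a = ⊤ ∨ ∃ S hS x, a = mk t S hS x := by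
  induction a using WithBot.recBotCoe with
  | bot => exact Or.inl rfl
  | coe a =>
    induction a using WithTop.recTopCoe with
    | top => exact Or.inr (Or.inl rfl)
    | coe a =>
      obtain ⟨⟨S, O⟩, hS, x, hO⟩ := a
      simp only at hO
      subst hO
      exact Or.inr (Or.inr ⟨S, hS, x, rfl⟩)

theorem bot_lt_mk {S : Finset (SignedIndex n)} (hS : IsCrossFace S) (x : X) :
    ⊥ < mk t S hS x := WithBot.bot_lt_coe _

theorem mk_lt_top {S : Finset (SignedIndex n)} (hS : IsCrossFace S) (x : X) :
    mk t S hS x < ⊤ := WithBot.coe_lt_coe.2 (WithTop.coe_lt_top _)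

theorem mk_le_mk_iff_subset {S S' : Finset (SignedIndex n)} (hS : IsCrossFace S)
    (hS' : IsCrossFace S') {x x' : X} :
    mk t S hS x ≤ mk t S' hS' x' ↔ S ⊆ S' ∧ orb t S x ⊆ orb t S' x' := by
  unfold mk
  rw [WithBot.coe_le_coe, WithTop.coe_le_coe]
  exact Iff.rfl

theorem mk_le_mk {S S' : Finset (SignedIndex n)} (hS : IsCrossFace S)
    (hS' : IsCrossFace S') {x x' : X} :
    mk t S hS x ≤ mk t S' hS' x' ↔ S ⊆ S' ∧ x ∈ orb t S' x' := by
  rw [mk_le_mk_iff_subset]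
  refine and_congr_right fun hSS => ⟨fun hx => hx (mem_orb_self t S x), fun hx y hy => ?_⟩
  exact orb_trans t hx (orb_mono t hSS x hy)

theorem mk_eq_mk {S S' : Finset (SignedIndex n)} (hS : IsCrossFace S)
    (hS' : IsCrossFace S') {x x' : X} :
    mk t S hS x = mk t S' hS' x' ↔ S = S' ∧ orb t S x = orb t S' x' := by
  unfold mk
  rw [WithBot.coe_inj, WithTop.coe_inj]
  constructor
  · intro e
    have := congrArg Subtype.val e
    simpa using this
  · rintro ⟨rfl, e⟩
    exact Subtype.ext (by simp [e])

theorem mk_eq_of_mem (ht : IsEdgeSystem t) {S : Finset (SignedIndex n)} (hS : IsCrossFace S)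
    {x y : X} (hxy : y ∈ orb t S x) : mk t S hS y = mk t S hS x :=
  (mk_eq_mk hS hS).2 ⟨rfl, orb_eq_of_mem ht.involutive hxy⟩

theorem mk_lt_mk (ht : IsEdgeSystem t) {S S' : Finset (SignedIndex n)} (hS : IsCrossFace S)
    (hS' : IsCrossFace S') {x x' : X} :
    mk t S hS x < mk t S' hS' x' ↔ S ⊂ S' ∧ x ∈ orb t S' x' := by
  rw [lt_iff_le_and_ne, mk_le_mk, Finset.ssubset_iff_subset_ne]
  constructor
  · rintro ⟨⟨h1, h2⟩, h3⟩
    refine ⟨⟨h1, ?_⟩, h2⟩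
    rintro rfl
    exact h3 (mk_eq_of_mem ht hS h2)
  · rintro ⟨⟨h1, h2⟩, h3⟩
    exact ⟨⟨h1, h3⟩, fun e => h2 ((mk_eq_mk hS hS').1 e).1⟩

/-- The rank of a face, counted from `0` for the least face. -/
def rk : FacePoset t → ℕ
  | none => 0
  | some none => n + 2
  | some (some p) => p.1.1.card + 1

theorem rk_bot : rk (⊥ : FacePoset t) = 0 := rfl

theorem rk_top : rk (⊤ : FacePoset t) = n + 2 := rfl

theorem rk_mk {S : Finset (SignedIndex n)} (hS : IsCrossFace S) (x : X) :
    rk (mk t S hS x) = S.card + 1 := rfl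

theorem isRankFunction (ht : IsEdgeSystem t) : IsRankFunction (rk (t := t)) (n + 2) where
  strictMono := by
    intro a b hab
    rcases cases_face a with rfl | rfl | ⟨S, hS, x, rfl⟩
    · rcases cases_face b with rfl | rfl | ⟨S', hS', x', rfl⟩
      · exact absurd hab (lt_irrefl _)
      · rw [rk_bot, rk_top]; omega
      · rw [rk_bot, rk_mk]; omega
    · exact absurd hab not_top_lt
    · have := hS.card_le
      rcases cases_face b with rfl | rfl | ⟨S', hS', x', rfl⟩
      · exact absurd hab not_lt_bot
      · rw [rk_mk, rk_top]; omega
      · rw [rk_mk, rk_mk]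
        have := Finset.card_lt_card ((mk_lt_mk ht hS hS').1 hab).1
        omega
  rk_bot := rfl
  rk_top := rfl
  exists_next := by
    intro a b hab
    rcases cases_face a with rfl | rfl | ⟨S, hS, x, rfl⟩
    · rcases cases_face b with rfl | rfl | ⟨S', hS', x', rfl⟩
      · exact absurd hab (lt_irrefl _)
      · exact ⟨mk t ∅ .empty ht.nonempty.some, bot_lt_mk _ _, le_top, by simp [rk_mk, rk_bot]⟩
      · exact ⟨mk t ∅ .empty x', bot_lt_mk _ _,
          (mk_le_mk _ _).2 ⟨Finset.empty_subset _, mem_orb_self t _ _⟩, by simp [rk_mk, rk_bot]⟩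
    · exact absurd hab not_top_lt
    · have hcard := hS.card_le
      rcases cases_face b with rfl | rfl | ⟨S', hS', x', rfl⟩
      · exact absurd hab not_lt_bot
      · rcases hcard.eq_or_lt with e | hlt
        · exact ⟨⊤, mk_lt_top _ _, le_rfl, by rw [rk_mk, rk_top, e]⟩
        · obtain ⟨i, hi⟩ := hS.exists_fresh hlt
          have hv : ((i, 1) : SignedIndex n) ∉ S := fun hm => hi _ hm rfl
          refine ⟨mk t (insert (i, 1) S) (hS.insert hi) x, ?_, le_top, ?_⟩
          · exact (mk_lt_mk ht _ _).2 ⟨Finset.ssubset_insert hv, mem_orb_self t _ _⟩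
          · rw [rk_mk, rk_mk, Finset.card_insert_of_notMem hv]
      · obtain ⟨hSS, hx⟩ := (mk_lt_mk ht hS hS').1 hab
        obtain ⟨v, hv', hv⟩ := Finset.exists_of_ssubset hSS
        have hsub : insert v S ⊆ S' := Finset.insert_subset hv' hSS.1
        refine ⟨mk t (insert v S) (hS'.mono hsub) x, ?_, ?_, ?_⟩
        · exact (mk_lt_mk ht _ _).2 ⟨Finset.ssubset_insert hv, mem_orb_self t _ _⟩
        · exact (mk_le_mk _ _).2 ⟨hsub, hx⟩
        · rw [rk_mk, rk_mk, Finset.card_insert_of_notMem hv]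

theorem isFlagged (ht : IsEdgeSystem t) : IsFlagged (FacePoset t) (n + 1) :=
  (isRankFunction ht).isFlagged rfl

/-- The faces above a given face at `x` can all be taken at `x`. -/
theorem exists_eq_mk_of_mk_lt (ht : IsEdgeSystem t) {S : Finset (SignedIndex n)}
    {hS : IsCrossFace S} {x : X} {a : FacePoset t} (ha : mk t S hS x < a) (ha' : a < ⊤) :
    ∃ T hT, a = mk t T hT x ∧ S ⊂ T := by
  rcases cases_face a with rfl | rfl | ⟨T, hT, y, rfl⟩
  · exact absurd ha not_lt_bot
  · exact absurd ha' (lt_irrefl _)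
  · obtain ⟨h1, h2⟩ := (mk_lt_mk ht hS hT).1 ha
    exact ⟨T, hT, (mk_eq_of_mem ht hT h2).symm, h1⟩

theorem diamond (hn : 0 < n) (ht : IsEdgeSystem t) : DiamondCondition (FacePoset t) := by
  intro F G hFG hr
  rw [(isRankFunction ht).faceRank_eq, (isRankFunction ht).faceRank_eq] at hr
  rw [Set.encard_eq_two]
  rcases cases_face F with rfl | rfl | ⟨S, hS, x, rfl⟩
  · rcases cases_face G with rfl | rfl | ⟨S', hS', x', rfl⟩
    · exact absurd hFG (lt_irrefl _)
    · rw [rk_bot, rk_top] at hr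
      push_cast at hr
      omega
    · -- an edge has two vertices
      rw [rk_bot, rk_mk] at hr
      obtain ⟨v, rfl⟩ := Finset.card_eq_one.1 (show S'.card = 1 by push_cast at hr; omega)
      refine ⟨mk t ∅ .empty x', mk t ∅ .empty (t v x'), ?_, ?_⟩
      · rw [ne_eq, mk_eq_mk, orb_empty, orb_empty, Set.singleton_eq_singleton_iff]
        exact fun e => ht.ne_self v x' e.2.symm
      · ext H
        constructor
        · rintro ⟨h1, h2⟩
          rcases cases_face H with rfl | rfl | ⟨T, hT, y, rfl⟩
          · exact absurd h1 (lt_irrefl _)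
          · exact absurd h2 not_top_lt
          · obtain ⟨h3, h4⟩ := (mk_lt_mk ht hT hS').1 h2
            rw [Finset.ssubset_singleton_iff] at h3
            subst h3
            rw [orb_singleton ht.involutive] at h4
            rcases h4 with rfl | rfl
            · exact Or.inl rfl
            · exact Or.inr rfl
        · rintro (rfl | rfl)
          · exact ⟨bot_lt_mk _ _, (mk_lt_mk ht _ _).2 ⟨by simp, mem_orb_self t _ _⟩⟩
          · exact ⟨bot_lt_mk _ _, (mk_lt_mk ht _ _).2
              ⟨by simp, apply_mem_orb t (Finset.mem_singleton_self v) x'⟩⟩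
  · exact absurd hFG not_top_lt
  · rcases cases_face G with rfl | rfl | ⟨S', hS', x', rfl⟩
    · exact absurd hFG not_lt_bot
    · -- exactly one coordinate does not occur in `S`, and it can be added with both signs
      rw [rk_top, rk_mk] at hr
      have hc : S.card + 1 = n := by push_cast at hr; omega
      obtain ⟨i, hi⟩ := hS.exists_fresh (by omega)
      have hmem : ∀ s, ((i, s) : SignedIndex n) ∉ S := fun s hm => hi _ hm rfl
      refine ⟨mk t (insert (i, 1) S) (hS.insert hi) x, mk t (insert (i, -1) S) (hS.insert hi) x,
        ?_, ?_⟩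
      · rw [ne_eq, mk_eq_mk]
        rintro ⟨e, -⟩
        have h1 : ((i, 1) : SignedIndex n) ∈ insert ((i, -1) : SignedIndex n) S :=
          e ▸ Finset.mem_insert_self _ _
        rcases Finset.mem_insert.1 h1 with h1 | h1
        · exact absurd (congrArg Prod.snd h1) (show (1 : ℤˣ) ≠ -1 by decide)
        · exact hmem 1 h1
      · ext H
        constructor
        · rintro ⟨h1, h2⟩
          obtain ⟨T, hT, rfl, hST⟩ := exists_eq_mk_of_mk_lt ht h1 h2
          obtain ⟨v, hvT, hvS⟩ := Finset.exists_of_ssubset hST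
          have hsub : insert v S ⊆ T := Finset.insert_subset hvT hST.1
          have hTv : insert v S = T := Finset.eq_of_subset_of_card_le hsub (by
            rw [Finset.card_insert_of_notMem hvS, hc]
            exact hT.card_le)
          subst hTv
          have hvi : v.1 = i := by
            by_contra hne
            have hbig := (hT.insert (v := (i, 1)) (by
              rintro w hw
              rcases Finset.mem_insert.1 hw with rfl | hw
              · exact hne
              · exact hi w hw)).card_le
            rw [Finset.card_insert_of_notMem, Finset.card_insert_of_notMem hvS] at hbig
            · omega
            · rw [Finset.mem_insert, not_or]
              exact ⟨fun e => hne (congrArg Prod.fst e).symm, hmem 1⟩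
          obtain ⟨j, s⟩ := v
          simp only at hvi
          subst hvi
          rcases Int.units_eq_one_or s with rfl | rfl
          · exact Or.inl rfl
          · exact Or.inr rfl
        · rintro (rfl | rfl)
          · exact ⟨(mk_lt_mk ht _ _).2 ⟨Finset.ssubset_insert (hmem _), mem_orb_self t _ _⟩,
              mk_lt_top _ _⟩
          · exact ⟨(mk_lt_mk ht _ _).2 ⟨Finset.ssubset_insert (hmem _), mem_orb_self t _ _⟩,
              mk_lt_top _ _⟩
    · rw [rk_mk, rk_mk] at hr
      obtain ⟨hSS, hx⟩ := (mk_lt_mk ht hS hS').1 hFG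
      have hc : (S' \ S).card = 2 := by
        rw [Finset.card_sdiff_of_subset hSS.1]
        push_cast at hr
        omega
      obtain ⟨v, w, hvw, hd⟩ := Finset.card_eq_two.1 hc
      have hv : v ∈ S' \ S := by simp [hd]
      have hw : w ∈ S' \ S := by simp [hd]
      rw [Finset.mem_sdiff] at hv hw
      have hlt : ∀ u, u ∈ S' → u ∉ S → insert u S ⊂ S' := fun u hu hu' => by
        refine Finset.ssubset_iff_subset_ne.2 ⟨Finset.insert_subset hu hSS.1, fun e => ?_⟩
        have := congrArg Finset.card e
        rw [Finset.card_insert_of_notMem hu'] at this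
        push_cast at hr
        omega
      refine ⟨mk t (insert v S) (hS'.mono (hlt v hv.1 hv.2).1) x,
        mk t (insert w S) (hS'.mono (hlt w hw.1 hw.2).1) x, ?_, ?_⟩
      · rw [ne_eq, mk_eq_mk]
        rintro ⟨e, -⟩
        have h1 : v ∈ insert w S := e ▸ Finset.mem_insert_self _ _
        rcases Finset.mem_insert.1 h1 with h1 | h1
        · exact hvw h1
        · exact hv.2 h1
      · ext H
        constructor
        · rintro ⟨h1, h2⟩
          obtain ⟨T, hT, rfl, hST⟩ := exists_eq_mk_of_mk_lt ht h1 (h2.trans (mk_lt_top _ _))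
          obtain ⟨u, huT, huS⟩ := Finset.exists_of_ssubset hST
          have hTS := ((mk_lt_mk ht _ _).1 h2).1
          have hTu : insert u S = T := Finset.eq_of_subset_of_card_le
            (Finset.insert_subset huT hST.1) (by
              rw [Finset.card_insert_of_notMem huS]
              have := Finset.card_lt_card hTS
              push_cast at hr
              omega)
          subst hTu
          have hu : u ∈ S' \ S := Finset.mem_sdiff.2 ⟨hTS.1 huT, huS⟩
          rw [hd, Finset.mem_insert, Finset.mem_singleton] at hu
          rcases hu with rfl | rfl
          · exact Or.inl rfl
          · exact Or.inr rfl
        · rintro (rfl | rfl)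
          · exact ⟨(mk_lt_mk ht _ _).2 ⟨Finset.ssubset_insert hv.2, mem_orb_self t _ _⟩,
              (mk_lt_mk ht _ _).2 ⟨hlt _ hv.1 hv.2, hx⟩⟩
          · exact ⟨(mk_lt_mk ht _ _).2 ⟨Finset.ssubset_insert hw.2, mem_orb_self t _ _⟩,
              (mk_lt_mk ht _ _).2 ⟨hlt _ hw.1 hw.2, hx⟩⟩

/-- The open intervals above the least face are connected: a face is joined to a vertex of it, and
vertices are joined along edges. -/
theorem connected_above_bot (ht : IsEdgeSystem t) {G : FacePoset t}
    (hr : rk (⊥ : FacePoset t) + 3 ≤ rk G) {a b : FacePoset t} (ha : ⊥ < a) (haG : a < G)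
    (hb : ⊥ < b) (hbG : b < G) :
    Relation.ReflTransGen (fun x y => (x ≤ y ∨ y ≤ x) ∧ ⊥ < y ∧ y < G) a b := by
  have hvert : ∀ a : FacePoset t, ⊥ < a → a < G → ∃ y, mk t ∅ .empty y ≤ a := by
    intro a ha haG
    rcases cases_face a with rfl | rfl | ⟨T, hT, y, rfl⟩
    · exact absurd ha (lt_irrefl _)
    · exact absurd haG not_top_lt
    · exact ⟨y, (mk_le_mk _ _).2 ⟨Finset.empty_subset _, mem_orb_self t _ _⟩⟩
  obtain ⟨y, hy⟩ := hvert a ha haG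
  obtain ⟨z, hz⟩ := hvert b hb hbG
  -- the labels and the points of the edges below `G`
  have hG : ∃ S', z ∈ orb t S' y ∧ ∀ u ∈ orb t S' y, mk t ∅ .empty u < G ∧
      ∀ v ∈ S', mk t {v} (.singleton v) u < G := by
    rcases cases_face G with rfl | rfl | ⟨S', hS', x', rfl⟩
    · exact absurd haG not_lt_bot
    · exact ⟨Finset.univ, ht.transitive y z, fun u _ => ⟨mk_lt_top _ _, fun v _ => mk_lt_top _ _⟩⟩
    · rw [rk_bot, rk_mk] at hr
      have hy' := ((mk_lt_mk ht _ _).1 (hy.trans_lt haG)).2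
      have hz' := ((mk_lt_mk ht _ _).1 (hz.trans_lt hbG)).2
      rw [← orb_eq_of_mem ht.involutive hy'] at hz'
      refine ⟨S', hz', fun u hu => ?_⟩
      have hu' := orb_trans t hy' hu
      have hlt : ∀ T : Finset (SignedIndex n), T ⊆ S' → T.card ≤ 1 → T ⊂ S' := fun T hT hc => by
        refine Finset.ssubset_iff_subset_ne.2 ⟨hT, ?_⟩
        rintro rfl
        omega
      exact ⟨(mk_lt_mk ht _ _).2 ⟨hlt _ (by simp) (by simp), hu'⟩,
        fun v hv => (mk_lt_mk ht _ _).2 ⟨hlt _ (by simpa using hv) (by simp), hu'⟩⟩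
  obtain ⟨S', hzy, hS'⟩ := hG
  refine Relation.ReflTransGen.head (b := mk t ∅ .empty y) ⟨Or.inr hy, bot_lt_mk _ _,
    hy.trans_lt haG⟩ (Relation.ReflTransGen.tail (b := mk t ∅ .empty z) ?_ ⟨Or.inl hz, hb, hbG⟩)
  clear hz hbG hb b
  induction hzy with
  | refl => exact Relation.ReflTransGen.refl
  | @tail p q hyb hbc ih =>
    obtain ⟨v, hv, rfl⟩ := hbc
    have hp := hS' p hyb
    have hq := hS' (t v p) (orb_trans t hyb (apply_mem_orb t hv p))
    refine (ih.tail (c := mk t {v} (.singleton v) p)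
      ⟨Or.inl ?_, bot_lt_mk _ _, hp.2 v hv⟩).tail ⟨Or.inr ?_, bot_lt_mk _ _, hq.1⟩
    · exact (mk_le_mk _ _).2 ⟨by simp, mem_orb_self t _ _⟩
    · exact (mk_le_mk _ _).2 ⟨by simp, apply_mem_orb t (Finset.mem_singleton_self v) p⟩

/-- The open intervals above a proper face are connected: a face is joined to a minimal one, and two
minimal ones with different coordinates lie in a common face. If `G` is the greatest face, there
may be two minimal ones with the same coordinate, and a third coordinate is needed. -/
theorem connected_above_mk (ht : IsEdgeSystem t) {S : Finset (SignedIndex n)} {hS : IsCrossFace S}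
    {x : X} {G : FacePoset t} (hr : rk (mk t S hS x) + 3 ≤ rk G) {a b : FacePoset t}
    (ha : mk t S hS x < a) (haG : a < G) (hb : mk t S hS x < b) (hbG : b < G) :
    Relation.ReflTransGen (fun y z => (y ≤ z ∨ z ≤ y) ∧ mk t S hS x < z ∧ z < G) a b := by
  have hmin : ∀ a : FacePoset t, mk t S hS x < a → a < G →
      ∃ v, ∃ hv : IsCrossFace (insert v S), v ∉ S ∧ mk t (insert v S) hv x ≤ a := by
    intro a ha haG
    obtain ⟨T, hT, rfl, hST⟩ := exists_eq_mk_of_mk_lt ht ha (haG.trans_le le_top)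
    obtain ⟨v, hvT, hvS⟩ := Finset.exists_of_ssubset hST
    have hsub := Finset.insert_subset hvT hST.1
    exact ⟨v, hT.mono hsub, hvS, (mk_le_mk _ _).2 ⟨hsub, mem_orb_self t _ _⟩⟩
  have hlt : ∀ v (hv : IsCrossFace (insert v S)), v ∉ S →
      mk t S hS x < mk t (insert v S) hv x := fun v hv hvS =>
    (mk_lt_mk ht _ _).2 ⟨Finset.ssubset_insert hvS, mem_orb_self t _ _⟩
  have hmid : ∀ v w (hv : IsCrossFace (insert v S)) (hw : IsCrossFace (insert w S)), v ∉ S →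
      w ∉ S → v.1 ≠ w.1 → mk t (insert v S) hv x < G → mk t (insert w S) hw x < G →
      Relation.ReflTransGen (fun y z => (y ≤ z ∨ z ≤ y) ∧ mk t S hS x < z ∧ z < G)
        (mk t (insert v S) hv x) (mk t (insert w S) hw x) := by
    intro v w hv hw hvS hwS hvw hvG hwG
    have hQ : IsCrossFace (insert w (insert v S)) := hv.insert (by
      intro u hu
      rcases Finset.mem_insert.1 hu with rfl | hu
      · exact hvw
      · exact hw.fst_ne hwS u hu)
    have hle1 : mk t (insert v S) hv x ≤ mk t _ hQ x :=
      (mk_le_mk _ _).2 ⟨Finset.subset_insert _ _, mem_orb_self t _ _⟩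
    have hle2 : mk t (insert w S) hw x ≤ mk t _ hQ x :=
      (mk_le_mk _ _).2 ⟨Finset.insert_subset_insert _ (Finset.subset_insert _ _),
        mem_orb_self t _ _⟩
    have hQG : mk t _ hQ x < G := by
      rcases cases_face G with rfl | rfl | ⟨S', hS', x', rfl⟩
      · exact absurd haG not_lt_bot
      · exact mk_lt_top _ _
      · obtain ⟨h1, hx⟩ := (mk_lt_mk ht _ _).1 hvG
        obtain ⟨h2, -⟩ := (mk_lt_mk ht _ _).1 hwG
        refine (mk_lt_mk ht _ _).2 ⟨Finset.ssubset_iff_subset_ne.2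
          ⟨Finset.insert_subset (h2.1 (Finset.mem_insert_self _ _)) h1.1, fun e => ?_⟩, hx⟩
        rw [rk_mk, rk_mk, ← e] at hr
        have := Finset.card_insert_le w (insert v S)
        have := Finset.card_insert_le v S
        omega
    exact (Relation.ReflTransGen.single ⟨Or.inl hle1, (hlt v hv hvS).trans_le hle1, hQG⟩).tail
      ⟨Or.inr hle2, hlt w hw hwS, hwG⟩
  obtain ⟨v, hv, hvS, hva⟩ := hmin a ha haG
  obtain ⟨w, hw, hwS, hwb⟩ := hmin b hb hbG
  refine Relation.ReflTransGen.head (b := mk t (insert v S) hv x) ⟨Or.inr hva, hlt v hv hvS,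
    hva.trans_lt haG⟩ (Relation.ReflTransGen.tail (b := mk t (insert w S) hw x) ?_
      ⟨Or.inl hwb, hb, hbG⟩)
  by_cases hvw : v.1 = w.1
  · rcases cases_face G with rfl | rfl | ⟨S', hS', x', rfl⟩
    · exact absurd haG not_lt_bot
    · rw [rk_mk, rk_top] at hr
      obtain ⟨i, hi⟩ := hv.exists_fresh (by
        rw [Finset.card_insert_of_notMem hvS]; omega)
      have hiS : ∀ u ∈ S, u.1 ≠ i := fun u hu => hi u (Finset.mem_insert_of_mem hu)
      have hi' : ((i, 1) : SignedIndex n) ∉ S := fun hm => hiS _ hm rfl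
      have hiv : v.1 ≠ i := hi v (Finset.mem_insert_self _ _)
      exact (hmid v (i, 1) hv (hS.insert hiS) hvS hi' hiv (mk_lt_top _ _) (mk_lt_top _ _)).trans
        (hmid (i, 1) w (hS.insert hiS) hw hi' hwS (fun e => hiv (hvw.trans e.symm))
          (mk_lt_top _ _) (mk_lt_top _ _))
    · have h1 := ((mk_lt_mk ht _ _).1 (hva.trans_lt haG)).1.1 (Finset.mem_insert_self _ _)
      have h2 := ((mk_lt_mk ht _ _).1 (hwb.trans_lt hbG)).1.1 (Finset.mem_insert_self _ _)
      have := hS' h1 h2 hvw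
      subst this
      exact Relation.ReflTransGen.refl
  · exact hmid v w hv hw hvS hwS hvw (hva.trans_lt haG) (hwb.trans_lt hbG)

theorem isAbstractPolytope (hn : 0 < n) (ht : IsEdgeSystem t) :
    IsAbstractPolytope (FacePoset t) (n + 1) where
  flagged := isFlagged ht
  diamond := diamond hn ht
  connected := by
    refine (isRankFunction ht).stronglyFlagConnected fun F G hr a b ha haG hb hbG => ?_
    rcases cases_face F with rfl | rfl | ⟨S, hS, x, rfl⟩
    · exact connected_above_bot ht hr ha haG hb hbG
    · exact absurd ha not_top_lt
    · exact connected_above_mk ht hr ha haG hb hbG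

end FacePoset

/-! ### Signed permutations -/

/-- The automorphism group of the cross-polytope: the permutations of its vertices that preserve
antipodality. -/
def signedPerm (n : ℕ) : Subgroup (Equiv.Perm (SignedIndex n)) where
  carrier := {g | ∀ i s, g (i, s) = ((g (i, 1)).1, s * (g (i, 1)).2)}
  one_mem' := by simp
  mul_mem' := by
    intro g h hg hh i s
    simp only [Set.mem_ofPred_eq, Equiv.Perm.mul_apply] at hg hh ⊢
    rw [hh i s, hg _ (s * _), hg (h (i, 1)).1 (h (i, 1)).2, mul_assoc]
  inv_mem' := by
    intro g hg i s
    simp only [Set.mem_ofPred_eq] at hg ⊢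
    rw [Equiv.Perm.inv_eq_iff_eq, hg]
    have h1 : g (g⁻¹ (i, 1)) = (i, 1) := by simp
    rw [← Prod.mk.eta (p := g⁻¹ (i, 1)), hg] at h1
    rw [Prod.mk.injEq] at h1 ⊢
    exact ⟨h1.1.symm, by rw [mul_assoc, h1.2, mul_one]⟩

namespace signedPerm

variable {n : ℕ}

theorem apply_eq (g : signedPerm n) (i : Fin n) (s : ℤˣ) :
    g.1 (i, s) = ((g.1 (i, 1)).1, s * (g.1 (i, 1)).2) := g.2 i s

theorem ext_one {g h : signedPerm n} (he : ∀ i, g.1 (i, 1) = h.1 (i, 1)) : g = h := by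
  refine Subtype.ext (Equiv.ext fun ⟨i, s⟩ => ?_)
  rw [apply_eq g, apply_eq h, he]

theorem fst_injective (g : signedPerm n) : Function.Injective fun i => (g.1 (i, 1)).1 := by
  intro i j hij
  simp only at hij
  have h1 : g.1 (i, (g.1 (i, 1)).2) = g.1 (j, (g.1 (j, 1)).2) := by
    rw [apply_eq, apply_eq g j, hij, Int.units_mul_self, Int.units_mul_self]
  exact congrArg Prod.fst (g.1.injective h1)

theorem fst_bijective (g : signedPerm n) : Function.Bijective fun i => (g.1 (i, 1)).1 :=
  Finite.injective_iff_bijective.1 (fst_injective g)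

/-- The signed permutation with given values at the vertices `(i, 1)`. -/
noncomputable def ofFrame (v : Fin n → SignedIndex n) (hv : Function.Injective fun i => (v i).1) :
    signedPerm n :=
  ⟨Equiv.ofBijective (fun p => ((v p.1).1, p.2 * (v p.1).2)) (by
    refine Finite.injective_iff_bijective.1 ?_
    rintro ⟨i, s⟩ ⟨j, r⟩ e
    rw [Prod.mk.injEq] at e
    obtain rfl := hv e.1
    exact Prod.ext rfl (mul_right_cancel e.2)), fun i s => by simp⟩

theorem ofFrame_apply_one (v : Fin n → SignedIndex n) (hv : Function.Injective fun i => (v i).1)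
    (i : Fin n) : (ofFrame v hv).1 (i, 1) = v i := by
  simp [ofFrame]

/-- The product of the signs of a signed permutation. -/
def sign (g : signedPerm n) : ℤˣ := ∏ i, (g.1 (i, 1)).2

theorem prod_comp {M : Type*} [CommMonoid M] (g : signedPerm n) (f : Fin n → M) :
    ∏ i, f (g.1 (i, 1)).1 = ∏ i, f i :=
  (fst_bijective g).prod_comp f

theorem sign_mul (g h : signedPerm n) : sign (g * h) = sign g * sign h := by
  have h1 : ∀ i, ((g * h).1 (i, 1)).2 = (g.1 ((h.1 (i, 1)).1, 1)).2 * (h.1 (i, 1)).2 := fun i => by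
    rw [Subgroup.coe_mul, Equiv.Perm.mul_apply, ← Prod.mk.eta (p := h.1 (i, 1)), apply_eq,
      mul_comm]
  unfold sign
  simp only [h1, Finset.prod_mul_distrib]
  rw [prod_comp h fun j => (g.1 (j, 1)).2]

theorem sign_one : sign (1 : signedPerm n) = 1 := by simp [sign]

theorem sign_inv (g : signedPerm n) : sign g⁻¹ = sign g := by
  have h1 : sign g⁻¹ * sign g = 1 := by rw [← sign_mul, inv_mul_cancel, sign_one]
  rw [eq_inv_of_mul_eq_one_left h1, Int.units_inv_eq_self]

/-- The exchange of two coordinates. -/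
def swap (i j : Fin n) : signedPerm n :=
  ⟨(Equiv.swap i j).prodCongr (Equiv.refl _), fun _ _ => by simp⟩

theorem swap_apply (i j k : Fin n) (s : ℤˣ) : (swap i j).1 (k, s) = (Equiv.swap i j k, s) := rfl

theorem sign_swap (i j : Fin n) : sign (swap i j) = 1 := by simp [sign, swap_apply]

/-- The change of the sign of one coordinate. -/
noncomputable def flip (i : Fin n) : signedPerm n :=
  ofFrame (fun k => (k, if k = i then -1 else 1)) Function.injective_id

theorem flip_apply_one (i k : Fin n) : (flip i).1 (k, 1) = (k, if k = i then -1 else 1) :=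
  ofFrame_apply_one _ _ _

theorem sign_flip (i : Fin n) : sign (flip i) = -1 := by
  simp [sign, flip_apply_one]

variable (n) in
/-- The standard generators of the group of the cross-polytope, numbered from `1` to `n` as the
colors of the polytope that they act on: adjacent transpositions and the change of the last sign. -/
noncomputable def gen (i : ℕ) : signedPerm n :=
  if h : 1 ≤ i ∧ i < n then swap ⟨i - 1, by omega⟩ ⟨i, h.2⟩
  else if h : 1 ≤ i ∧ i = n then flip ⟨i - 1, by omega⟩ else 1

theorem sign_gen_of_lt {i : ℕ} (h1 : 1 ≤ i) (h2 : i < n) : sign (gen n i) = 1 := by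
  rw [gen, dif_pos ⟨h1, h2⟩, sign_swap]

theorem sign_gen_self (h1 : 1 ≤ n) : sign (gen n n) = -1 := by
  rw [gen, dif_neg (by omega), dif_pos ⟨h1, rfl⟩, sign_flip]

/-- The face of the cross-polytope spanned by the images of the first `j` basis vectors. -/
def label (a : signedPerm n) (j : ℕ) : Finset (SignedIndex n) :=
  (Finset.univ.filter fun i : Fin n => (i : ℕ) < j).image fun i => a.1 (i, 1)

theorem mem_label {a : signedPerm n} {j : ℕ} {v : SignedIndex n} :
    v ∈ label a j ↔ ∃ i : Fin n, (i : ℕ) < j ∧ a.1 (i, 1) = v := by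
  simp [label]

theorem isCrossFace_label (a : signedPerm n) (j : ℕ) : IsCrossFace (label a j) := by
  intro v hv w hw hvw
  obtain ⟨i, -, rfl⟩ := mem_label.1 hv
  obtain ⟨k, -, rfl⟩ := mem_label.1 hw
  rw [fst_injective a hvw]

theorem apply_mem_label {a : signedPerm n} {i : Fin n} {j : ℕ} :
    a.1 (i, 1) ∈ label a j ↔ (i : ℕ) < j := by
  rw [mem_label]
  refine ⟨?_, fun hi => ⟨i, hi, rfl⟩⟩
  rintro ⟨k, hk, e⟩
  have := congrArg Prod.fst (a.1.injective e)
  simp only at this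
  rwa [← this]

theorem label_mono (a : signedPerm n) {j k : ℕ} (hjk : j ≤ k) : label a j ⊆ label a k := by
  intro v hv
  obtain ⟨i, hi, rfl⟩ := mem_label.1 hv
  exact apply_mem_label.2 (by omega)

theorem label_zero (a : signedPerm n) : label a 0 = ∅ := by simp [label]

theorem label_succ (a : signedPerm n) (i : Fin n) :
    label a (i + 1) = insert (a.1 (i, 1)) (label a i) := by
  ext v
  rw [Finset.mem_insert, mem_label, mem_label]
  constructor
  · rintro ⟨k, hk, rfl⟩
    rcases Nat.lt_succ_iff_lt_or_eq.1 hk with h | h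
    · exact Or.inr ⟨k, h, rfl⟩
    · exact Or.inl (by rw [Fin.ext h])
  · rintro (rfl | ⟨k, hk, rfl⟩)
    · exact ⟨i, by omega, rfl⟩
    · exact ⟨k, by omega, rfl⟩

theorem card_label (a : signedPerm n) {j : ℕ} (hj : j ≤ n) : (label a j).card = j := by
  induction j with
  | zero => simp [label_zero]
  | succ j ih =>
    rw [label_succ a ⟨j, hj⟩, Finset.card_insert_of_notMem, ih (by omega)]
    exact fun hm => absurd (apply_mem_label.1 hm) (lt_irrefl _)

theorem eq_of_label_eq {a b : signedPerm n} (he : ∀ j ≤ n, label a j = label b j) : a = b := by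
  refine ext_one fun i => ?_
  have h1 : a.1 (i, 1) ∈ label b (i + 1) := by
    rw [← he _ i.2]
    exact apply_mem_label.2 (by omega)
  rw [label_succ, Finset.mem_insert, ← he _ i.2.le] at h1
  exact h1.resolve_right fun hm => absurd (apply_mem_label.1 hm) (lt_irrefl _)

theorem label_mul_gen (a : signedPerm n) {i j : ℕ} (hj : j ≤ n) (hij : j ≠ i) :
    label (a * gen n i) j = label a j := by
  have key : ∀ k : Fin n, (k : ℕ) < j → (a * gen n i).1 (k, 1) ∈ label a j := by
    intro k hk
    rw [Subgroup.coe_mul, Equiv.Perm.mul_apply, gen]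
    split_ifs with h1 h2
    · rw [swap_apply, apply_mem_label, Equiv.swap_apply_def]
      split_ifs with h3 h4
      · rw [Fin.ext_iff] at h3
        simp only at h3 ⊢
        omega
      · rw [Fin.ext_iff] at h4
        simp only at h4 ⊢
        omega
      · exact hk
    · rw [flip_apply_one, if_neg, apply_mem_label]
      · exact hk
      · rw [Fin.ext_iff]
        simp only
        omega
    · exact apply_mem_label.2 hk
  refine Finset.eq_of_subset_of_card_le (fun v hv => ?_) (by rw [card_label _ hj, card_label _ hj])
  obtain ⟨k, hk, rfl⟩ := mem_label.1 hv
  exact key k hk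

theorem label_mul_gen_ne (a : signedPerm n) {i : ℕ} (h1 : 1 ≤ i) (h2 : i ≤ n) :
    label (a * gen n i) i ≠ label a i := by
  intro he
  have hm : (a * gen n i).1 (⟨i - 1, by omega⟩, 1) ∈ label a i := by
    rw [← he, apply_mem_label]
    simp only
    omega
  rw [Subgroup.coe_mul, Equiv.Perm.mul_apply, gen] at hm
  split_ifs at hm with h3 h4
  · rw [swap_apply, apply_mem_label, Equiv.swap_apply_left] at hm
    exact lt_irrefl _ hm
  · rw [flip_apply_one, if_pos rfl] at hm
    obtain ⟨k, hk, e⟩ := mem_label.1 hm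
    exact absurd (congrArg Prod.snd (a.1.injective e)) (show (1 : ℤˣ) ≠ -1 by decide)
  · omega

end signedPerm

/-! ### The flags of the polytope -/

namespace FacePoset

variable {n : ℕ} {X : Type} {t : SignedIndex n → X → X}

open signedPerm

/-- The faces of the flag at the point `x` whose labels are the faces of the flag of the
cross-polytope given by `a`. -/
def flagSeq (t : SignedIndex n → X → X) (p : X × signedPerm n) : ℕ → FacePoset t
  | 0 => ⊥
  | j + 1 => if j ≤ n then mk t (label p.2 j) (isCrossFace_label _ _) p.1 else ⊤

theorem flagSeq_succ (p : X × signedPerm n) {j : ℕ} (hj : j ≤ n) :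
    flagSeq t p (j + 1) = mk t (label p.2 j) (isCrossFace_label _ _) p.1 := if_pos hj

theorem flagSeq_of_lt (p : X × signedPerm n) {j : ℕ} (hj : n < j) :
    flagSeq t p (j + 1) = ⊤ := if_neg hj.not_ge

theorem rk_flagSeq (p : X × signedPerm n) : ∀ k ≤ n + 2, rk (flagSeq t p k) = k
  | 0, _ => rfl
  | j + 1, hj => by
    by_cases h : j ≤ n
    · rw [flagSeq_succ _ h, rk_mk, card_label _ h]
    · rw [flagSeq_of_lt _ (not_le.1 h), rk_top]; omega

theorem flagSeq_mono (p : X × signedPerm n) : ∀ k l, k ≤ l → flagSeq t p k ≤ flagSeq t p l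
  | 0, _, _ => bot_le
  | j + 1, 0, h => by omega
  | j + 1, l + 1, h => by
    by_cases hl : l ≤ n
    · rw [flagSeq_succ _ hl, flagSeq_succ _ (by omega)]
      exact (mk_le_mk _ _).2 ⟨label_mono _ (by omega), mem_orb_self t _ _⟩
    · rw [flagSeq_of_lt _ (not_le.1 hl)]
      exact le_top

/-- The flag of the polytope given by a point and a signed permutation. -/
def flagOf (ht : IsEdgeSystem t) (p : X × signedPerm n) : Flag (FacePoset t) :=
  (isRankFunction ht).flagOfSeq (flagSeq t p) (rk_flagSeq p) (flagSeq_mono p)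

theorem face_flagOf (ht : IsEdgeSystem t) (p : X × signedPerm n) {k : ℕ} (hk : k ≤ n + 2) :
    (isRankFunction ht).face (flagOf ht p) k = flagSeq t p k :=
  (isRankFunction ht).face_flagOfSeq _ _ _ hk

theorem flagOf_injective (ht : IsEdgeSystem t) : Function.Injective (flagOf ht) := by
  rintro ⟨x, a⟩ ⟨y, b⟩ e
  have hseq : ∀ j ≤ n, mk t (label a j) (isCrossFace_label _ _) x =
      mk t (label b j) (isCrossFace_label _ _) y := fun j hj => by
    have h1 := face_flagOf ht (x, a) (k := j + 1) (by omega)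
    rw [e, face_flagOf ht _ (by omega), flagSeq_succ _ hj, flagSeq_succ _ hj] at h1
    exact h1.symm
  have hx : x = y := by
    have h1 := ((mk_eq_mk _ _).1 (hseq 0 (Nat.zero_le _))).2
    rw [label_zero, label_zero, orb_empty, orb_empty] at h1
    exact Set.singleton_eq_singleton_iff.1 h1
  have ha : a = b := eq_of_label_eq fun j hj => ((mk_eq_mk _ _).1 (hseq j hj)).1
  rw [hx, ha]

theorem flagOf_surjective (ht : IsEdgeSystem t) : Function.Surjective (flagOf ht) := by
  intro Φ
  let h := isRankFunction ht
  have hmk : ∀ j ≤ n, ∃ S hS x, h.face Φ (j + 1) = mk t S hS x ∧ S.card = j := by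
    intro j hj
    have hr := h.rk_face Φ (k := j + 1) (by omega)
    rcases cases_face (h.face Φ (j + 1)) with e | e | ⟨S, hS, x, e⟩
    · rw [e, rk_bot] at hr; omega
    · rw [e, rk_top] at hr; omega
    · rw [e, rk_mk] at hr
      exact ⟨S, hS, x, e, by omega⟩
  obtain ⟨S₀, hS₀, x, hx, hc₀⟩ := hmk 0 (Nat.zero_le n)
  have hmk' : ∀ j, ∃ S, ∃ hS : IsCrossFace S, j ≤ n →
      h.face Φ (j + 1) = mk t S hS x ∧ S.card = j := by
    intro j
    by_cases hj : j ≤ n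
    · obtain ⟨S, hS, y, e, hc⟩ := hmk j hj
      refine ⟨S, hS, fun _ => ⟨?_, hc⟩⟩
      have hle := h.face_le Φ (k := 0 + 1) (l := j + 1) (by omega) (by omega)
      rw [hx, e] at hle
      rw [e, mk_eq_of_mem ht hS ((mk_le_mk _ _).1 hle).2]
    · exact ⟨∅, .empty, fun h => absurd h hj⟩
  choose S hS hface using hmk'
  have hsub : ∀ j k, j ≤ k → k ≤ n → S j ⊆ S k := fun j k hjk hk => by
    have hle := h.face_le Φ (k := j + 1) (l := k + 1) (by omega) (by omega)
    rw [(hface j (hjk.trans hk)).1, (hface k hk).1] at hle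
    exact ((mk_le_mk _ _).1 hle).1
  have hex : ∀ i : Fin n, ∃ v, v ∉ S i ∧ v ∈ S (i + 1) := fun i => by
    have h1 := (hface i i.2.le).2
    have h2 := (hface (i + 1) i.2).2
    obtain ⟨v, hv, hv'⟩ := Finset.exists_mem_notMem_of_card_lt_card (s := S i) (t := S (i + 1))
      (by omega)
    exact ⟨v, hv', hv⟩
  choose v hv hv' using hex
  have hinj : Function.Injective fun i => (v i).1 := by
    have hlt : ∀ i j : Fin n, i < j → (v i).1 ≠ (v j).1 := fun i j hij e => by
      have h1 : v i ∈ S j := hsub (i + 1) j hij j.2.le (hv' i)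
      have h2 := hS (j + 1) (hsub j (j + 1) (by omega) j.2 h1) (hv' j) e
      exact hv j (h2 ▸ h1)
    intro i j e
    rcases lt_trichotomy i j with hij | hij | hij
    · exact absurd e (hlt i j hij)
    · exact hij
    · exact absurd e.symm (hlt j i hij)
  have hlabel : ∀ j ≤ n, label (ofFrame v hinj) j = S j := by
    intro j hj
    refine Finset.eq_of_subset_of_card_le (fun w hw => ?_) ?_
    · obtain ⟨i, hi, rfl⟩ := mem_label.1 hw
      rw [ofFrame_apply_one]
      exact hsub (i + 1) j hi hj (hv' i)
    · rw [(hface j hj).2, card_label _ hj]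
  refine ⟨(x, ofFrame v hinj), h.flag_ext fun k hk => ?_⟩
  rw [face_flagOf ht _ hk]
  rcases k with _ | j
  · exact (h.face_zero Φ).symm
  · by_cases hj : j ≤ n
    · rw [flagSeq_succ _ hj, (hface j hj).1, mk_eq_mk]
      simp only [hlabel j hj, true_and]
    · obtain rfl : j = n + 1 := by omega
      rw [h.face_top]
      exact flagSeq_of_lt _ (Nat.lt_succ_self n)

/-- The flags of the polytope are the pairs of a point and a signed permutation. -/
noncomputable def flagEquiv (ht : IsEdgeSystem t) : X × signedPerm n ≃ Flag (FacePoset t) :=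
  Equiv.ofBijective (flagOf ht) ⟨flagOf_injective ht, flagOf_surjective ht⟩

/-- The pair that gives the `i`-adjacent flag. -/
noncomputable def nbr (t : SignedIndex n → X → X) (hn : 0 < n) (i : ℕ) (p : X × signedPerm n) :
    X × signedPerm n :=
  if i = 0 then (t (p.2.1 (⟨0, hn⟩, 1)) p.1, p.2) else (p.1, p.2 * gen n i)

theorem nbr_zero (hn : 0 < n) (p : X × signedPerm n) :
    nbr t hn 0 p = (t (p.2.1 (⟨0, hn⟩, 1)) p.1, p.2) := if_pos rfl

theorem nbr_of_ne_zero (hn : 0 < n) {i : ℕ} (hi : i ≠ 0) (p : X × signedPerm n) :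
    nbr t hn i p = (p.1, p.2 * gen n i) := if_neg hi

theorem adjacent_nbr (hn : 0 < n) (ht : IsEdgeSystem t) {i : ℕ} (hi : i ≤ n)
    (p : X × signedPerm n) : Flag.Adjacent i (flagOf ht p) (flagOf ht (nbr t hn i p)) := by
  rw [(isRankFunction ht).adjacent_iff _ _ (by omega)]
  have hrest : ∀ q : X × signedPerm n, (∀ j ≤ n, j ≠ i →
      mk t (label p.2 j) (isCrossFace_label _ _) p.1 =
        mk t (label q.2 j) (isCrossFace_label _ _) q.1) →
      ∀ k ≤ n + 2, k ≠ i + 1 → (isRankFunction ht).face (flagOf ht p) k =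
        (isRankFunction ht).face (flagOf ht q) k := by
    intro q hq k hk hki
    rw [face_flagOf ht _ hk, face_flagOf ht _ hk]
    rcases k with _ | j
    · rfl
    · by_cases hj : j ≤ n
      · rw [flagSeq_succ _ hj, flagSeq_succ _ hj]
        exact hq j hj (by omega)
      · rw [flagSeq_of_lt _ (not_le.1 hj), flagSeq_of_lt _ (not_le.1 hj)]
  rw [face_flagOf ht _ (by omega), face_flagOf ht _ (by omega), flagSeq_succ _ hi,
    flagSeq_succ _ hi]
  by_cases h0 : i = 0
  · subst h0
    rw [nbr_zero]
    refine ⟨hrest _ fun j hj hj0 => ?_, ?_⟩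
    · refine (mk_eq_of_mem ht _ (apply_mem_orb t ?_ _)).symm
      exact apply_mem_label.2 (Nat.pos_of_ne_zero hj0)
    · rw [ne_eq, mk_eq_mk, label_zero, orb_empty, orb_empty, Set.singleton_eq_singleton_iff]
      exact fun e => ht.ne_self _ _ e.2.symm
  · rw [nbr_of_ne_zero hn h0]
    refine ⟨hrest _ fun j hj hji => ?_, ?_⟩
    · rw [mk_eq_mk]
      simp only [label_mul_gen p.2 hj hji, true_and]
    · rw [ne_eq, mk_eq_mk]
      exact fun e => label_mul_gen_ne p.2 (Nat.pos_of_ne_zero h0) hi e.1.symm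

theorem adjacent_flagOf_iff (hn : 0 < n) (ht : IsEdgeSystem t) {i : ℕ} (hi : i ≤ n)
    (p q : X × signedPerm n) :
    Flag.Adjacent i (flagOf ht p) (flagOf ht q) ↔ q = nbr t hn i p := by
  refine ⟨fun h => flagOf_injective ht ?_, ?_⟩
  · exact (isRankFunction ht).adjacent_unique (diamond hn ht) (by omega) h
      (adjacent_nbr hn ht hi p)
  · rintro rfl
    exact adjacent_nbr hn ht hi p

/-- The signed permutations are generated by the adjacent transpositions and the change of the last
sign: this is strong connectedness for two flags with a common vertex. -/
theorem reflTransGen_gen (hn : 0 < n) (ht : IsEdgeSystem t) (a b : signedPerm n) :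
    Relation.ReflTransGen (fun c d => ∃ i, 1 ≤ i ∧ i ≤ n ∧ d = c * gen n i) a b := by
  obtain ⟨x⟩ := ht.nonempty
  have hpath := (isAbstractPolytope hn ht).connected (flagOf ht (x, a)) (flagOf ht (x, b))
  have key : ∀ Φ, Relation.ReflTransGen (fun A B => ∃ i, Flag.Adjacent i A B ∧
      (flagOf ht (x, a)).faceAt i ≠ (flagOf ht (x, b)).faceAt i) (flagOf ht (x, a)) Φ →
      ∃ c, Φ = flagOf ht (x, c) ∧
        Relation.ReflTransGen (fun c d => ∃ i, 1 ≤ i ∧ i ≤ n ∧ d = c * gen n i) a c := by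
    intro Φ hΦ
    induction hΦ with
    | refl => exact ⟨a, rfl, Relation.ReflTransGen.refl⟩
    | @tail A B _ hAB ih =>
      obtain ⟨c, rfl, hc⟩ := ih
      obtain ⟨i, hi, hne⟩ := hAB
      have hin : i ≤ n := by
        have := (isRankFunction ht).le_of_faceAt_ne hne
        omega
      have hi0 : i ≠ 0 := by
        rintro rfl
        refine hne ?_
        rw [(isRankFunction ht).faceAt_eq _ (by omega), (isRankFunction ht).faceAt_eq _ (by omega),
          face_flagOf ht _ (by omega), face_flagOf ht _ (by omega), flagSeq_succ _ (by omega),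
          flagSeq_succ _ (by omega), Set.singleton_eq_singleton_iff, mk_eq_mk]
        simp only [label_zero, true_and]
      obtain ⟨q, rfl⟩ := flagOf_surjective ht B
      rw [adjacent_flagOf_iff hn ht hin, nbr_of_ne_zero hn hi0] at hi
      subst hi
      exact ⟨c * gen n i, rfl, hc.tail ⟨i, Nat.pos_of_ne_zero hi0, hin, rfl⟩⟩
  obtain ⟨c, hc, hac⟩ := key _ hpath
  have := congrArg Prod.snd (flagOf_injective ht hc)
  simp only at this
  rwa [this]

end FacePoset

/-! ### A commutator word and its naturality -/

section Word

variable {n : ℕ} {G H : Type*} [Group G] [Group H]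

/-- The product of the elements attached to the two vertices in direction `i`. -/
def pairProd (τ : SignedIndex n → G) (i : Fin n) : G := τ (i, -1) * τ (i, 1)

/-- If `m` is a translation by `d` and `b` is affine with linear part `l`, then this is the
translation by `(l - l⁻¹) * d`. -/
def conjDiff (b m : G) : G := b * m * b⁻¹ * (b⁻¹ * m⁻¹ * b)

/-- The commutator of the first two of the elements `pairProd τ i`. -/
def baseComm (hn : 2 ≤ n) (τ : SignedIndex n → G) : G :=
  pairProd τ ⟨0, by omega⟩ * pairProd τ ⟨1, by omega⟩ * (pairProd τ ⟨0, by omega⟩)⁻¹ *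
    (pairProd τ ⟨1, by omega⟩)⁻¹

/-- The word that tells the two kinds of flags apart: if the `pairProd τ i` are affine with linear
parts `lᵢ`, then it is the translation by `(∏ (lᵢ - lᵢ⁻¹) - 1) * d`, where `baseComm hn τ` is the
translation by `d`. -/
def chiralWord (hn : 2 ≤ n) (τ : SignedIndex n → G) : G :=
  (List.finRange n).foldr (fun i m => conjDiff (pairProd τ i) m) (baseComm hn τ) *
    (baseComm hn τ)⁻¹

theorem map_chiralWord (hn : 2 ≤ n) (φ : G →* H) (τ : SignedIndex n → G) :
    φ (chiralWord hn τ) = chiralWord hn (fun v => φ (τ v)) := by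
  have hbase : φ (baseComm hn τ) = baseComm hn (fun v => φ (τ v)) := by
    simp [baseComm, pairProd]
  have hfold : ∀ L : List (Fin n),
      φ (L.foldr (fun i m => conjDiff (pairProd τ i) m) (baseComm hn τ)) =
        L.foldr (fun i m => conjDiff (pairProd (fun v => φ (τ v)) i) m)
          (baseComm hn fun v => φ (τ v)) := by
    intro L
    induction L with
    | nil => exact hbase
    | cons i L ih =>
      rw [List.foldr_cons, List.foldr_cons, ← ih]
      simp [conjDiff, pairProd]
  rw [chiralWord, map_mul, map_inv, hbase, hfold, chiralWord]

end Word

/-! ### Involutions that act by affine maps -/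

/-- The points on which the auxiliary involutions act: the signs keep track of how often each
coordinate direction has been crossed. -/
abbrev SignedPoint (n : ℕ) := (Fin n → ℤˣ) × ZMod 11

/-- The permutation `f` fixes the signs `x`, and acts as the affine map `p ↦ l * p + c` over
them. -/
def IsAffineAt {n : ℕ} (f : Equiv.Perm (SignedPoint n)) (x : Fin n → ℤˣ) (l c : ZMod 11) : Prop :=
  ∀ p, f (x, p) = (x, l * p + c)

namespace IsAffineAt

variable {n : ℕ} {f g : Equiv.Perm (SignedPoint n)} {x : Fin n → ℤˣ} {l l' c c' d : ZMod 11}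

theorem mul (hf : IsAffineAt f x l c) (hg : IsAffineAt g x l' c') :
    IsAffineAt (f * g) x (l * l') (l * c' + c) := fun p => by
  rw [Equiv.Perm.mul_apply, hg, hf]
  exact Prod.ext rfl (by simp only; ring)

theorem inv (hf : IsAffineAt f x l c) (hl : l * l' = 1) :
    IsAffineAt f⁻¹ x l' (-(l' * c)) := fun p => by
  rw [Equiv.Perm.inv_eq_iff_eq, hf]
  refine Prod.ext rfl ?_
  simp only
  linear_combination (c - p) * hl

theorem congr {l₂ c₂ : ZMod 11} (hf : IsAffineAt f x l c) (hl : l = l₂) (hc : c = c₂) :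
    IsAffineAt f x l₂ c₂ := hl ▸ hc ▸ hf

theorem conjDiff (hf : IsAffineAt f x l c) (hl : l * l' = 1) (hg : IsAffineAt g x 1 d) :
    IsAffineAt (conjDiff f g) x 1 ((l - l') * d) := by
  have hg' := hg.inv (l' := 1) (by ring)
  have hf' := hf.inv hl
  refine (((hf.mul hg).mul hf').mul ((hf'.mul hg').mul hf)).congr ?_ ?_
  · linear_combination (l * l' + 1) * hl
  · linear_combination (-(c + l' * d)) * hl

theorem commutator (hf : IsAffineAt f x l c) (hl : l * l' = 1) {m m' : ZMod 11}
    (hg : IsAffineAt g x m d) (hm : m * m' = 1) :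
    IsAffineAt (f * g * f⁻¹ * g⁻¹) x 1 (c * (1 - m) - d * (1 - l)) := by
  refine (((hf.mul hg).mul (hf.inv hl)).mul (hg.inv hm)).congr ?_ ?_
  · linear_combination m * m' * hl + hm
  · linear_combination (-(d * m * m' + c * m)) * hl - d * hm

end IsAffineAt

section Gadget

variable {n : ℕ}

/-- The linear part of `pairProd` over a point with the given sign: `4` is chosen as a solution of
`l - l⁻¹ = 1`. -/
def lin (e : ℤˣ) : ZMod 11 := if e = 1 then 4 else 3

theorem lin_mul_lin_neg (e : ℤˣ) : lin e * lin (-e) = 1 := by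
  rcases Int.units_eq_one_or e with rfl | rfl <;> decide

theorem lin_sub_lin_neg (e : ℤˣ) : lin e - lin (-e) = ((e : ℤ) : ZMod 11) := by
  rcases Int.units_eq_one_or e with rfl | rfl <;> decide

theorem isAffineAt_chiralWord (hn : 2 ≤ n) {τ : SignedIndex n → Equiv.Perm (SignedPoint n)}
    {x : Fin n → ℤˣ} {e : Fin n → ℤˣ} {c : Fin n → ZMod 11}
    (h : ∀ i, IsAffineAt (pairProd τ i) x (lin (e i)) (c i)) :
    IsAffineAt (chiralWord hn τ) x 1 (((((∏ i, e i : ℤˣ) : ℤ) : ZMod 11) - 1) *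
      (c ⟨0, by omega⟩ * (1 - lin (e ⟨1, by omega⟩)) -
        c ⟨1, by omega⟩ * (1 - lin (e ⟨0, by omega⟩)))) := by
  set d := c ⟨0, by omega⟩ * (1 - lin (e ⟨1, by omega⟩)) -
        c ⟨1, by omega⟩ * (1 - lin (e ⟨0, by omega⟩)) with hd
  have hbase : IsAffineAt (baseComm hn τ) x 1 d :=
    (h _).commutator (lin_mul_lin_neg _) (h _) (lin_mul_lin_neg _)
  have hfold : ∀ L : List (Fin n), IsAffineAt
      (L.foldr (fun i m => conjDiff (pairProd τ i) m) (baseComm hn τ)) x 1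
      ((((L.map e).prod : ℤˣ) : ℤ) * d) := by
    intro L
    induction L with
    | nil => exact hbase.congr rfl (by simp)
    | cons i L ih =>
      refine ((h i).conjDiff (lin_mul_lin_neg _) ih).congr rfl ?_
      rw [lin_sub_lin_neg, List.map_cons, List.prod_cons]
      push_cast
      ring
  have hprod : ((List.finRange n).map e).prod = ∏ i, e i := by
    rw [Fin.prod_univ_def]
  refine ((hfold (List.finRange n)).mul (hbase.inv (l' := 1) (by ring))).congr (by ring) ?_
  rw [hprod]
  ring

/-- The affine map `p ↦ 2 * p + c`. -/
def doubling (c : ZMod 11) : Equiv.Perm (ZMod 11) where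
  toFun p := 2 * p + c
  invFun p := 6 * (p - c)
  left_inv p := by
    have h11 : (11 : ZMod 11) = 0 := by decide
    linear_combination p * h11
  right_inv p := by
    have h11 : (11 : ZMod 11) = 0 := by decide
    linear_combination (p - c) * h11

/-- The translation parts are chosen such that the first two of the affine maps do not commute. -/
def shift (i : Fin n) : ZMod 11 := if (i : ℕ) = 0 then 1 else 0

theorem involutive_crossing (v : SignedIndex n) :
    Function.Involutive fun z : SignedPoint n => (Function.update z.1 v.1 (-z.1 v.1),
      (doubling (shift v.1) ^ ((v.2 * z.1 v.1 : ℤˣ) : ℤ)) z.2) := by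
  rintro ⟨x, p⟩
  refine Prod.ext (by simp) ?_
  simp only [Function.update_self, mul_neg, Units.val_neg, zpow_neg]
  exact Equiv.symm_apply_apply _ _

/-- The involutions that give rise to the vertex set of the polytope: crossing the direction `i` in
the sense of `s` changes the sign `x i` and acts by the affine map of `i` or its inverse. -/
def crossing (v : SignedIndex n) : Equiv.Perm (SignedPoint n) :=
  (involutive_crossing v).toPerm

theorem crossing_apply (i : Fin n) (s : ℤˣ) (x : Fin n → ℤˣ) (p : ZMod 11) :
    crossing (i, s) (x, p) = (Function.update x i (-x i),
        (doubling (shift i) ^ ((s * x i : ℤˣ) : ℤ)) p) := rfl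

theorem crossing_mul_self (v : SignedIndex n) : crossing v * crossing v = 1 :=
  Equiv.ext (involutive_crossing v)

theorem isAffineAt_pairProd (g : signedPerm n) (x : Fin n → ℤˣ) (i : Fin n) :
    IsAffineAt (pairProd (fun v => crossing (g.1 v)) i) x
      (lin ((g.1 (i, 1)).2 * x (g.1 (i, 1)).1))
      ((if (g.1 (i, 1)).2 * x (g.1 (i, 1)).1 = 1 then 3 else 2) * shift (g.1 (i, 1)).1) := by
  intro p
  have h11 : (11 : ZMod 11) = 0 := by decide
  rw [pairProd, Equiv.Perm.mul_apply, signedPerm.apply_eq g i (-1)]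
  generalize g.1 (i, 1) = w
  obtain ⟨j, s⟩ := w
  rw [crossing_apply, crossing_apply]
  refine Prod.ext (by simp) ?_
  simp only [Function.update_self, neg_mul, one_mul, mul_neg, neg_neg]
  rcases Int.units_eq_one_or (s * x j) with e | e <;> rw [e]
  · simp [doubling, lin]
    ring
  · simp [doubling, lin]
    linear_combination (3 * p - 4 * shift j) * h11

end Gadget

/-! ### The vertex set of the polytope -/

section VertexSet

variable {n : ℕ}

/-- The action of the free group on the vertices of the cross-polytope by the maps `crossing`. -/
def act : FreeGroup (SignedIndex n) →* Equiv.Perm (SignedPoint n) := FreeGroup.lift crossing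

theorem act_of (v : SignedIndex n) : act (FreeGroup.of v) = crossing v := by simp [act]

/-- The action of signed permutations on the free group. -/
def twist (g : signedPerm n) : FreeGroup (SignedIndex n) →* FreeGroup (SignedIndex n) :=
  FreeGroup.map g.1

theorem twist_of (g : signedPerm n) (v : SignedIndex n) :
    twist g (FreeGroup.of v) = FreeGroup.of (g.1 v) := by simp [twist]

theorem twist_mul (g h : signedPerm n) (u : FreeGroup (SignedIndex n)) :
    twist (g * h) u = twist g (twist h u) := by
  simp only [twist, FreeGroup.map.comp, Subgroup.coe_mul, Equiv.Perm.coe_mul]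

theorem twist_one (u : FreeGroup (SignedIndex n)) : twist 1 u = u := by
  simp [twist, Equiv.Perm.coe_one]

theorem twist_inv_twist (g : signedPerm n) (u : FreeGroup (SignedIndex n)) :
    twist g⁻¹ (twist g u) = u := by rw [← twist_mul, inv_mul_cancel, twist_one]

theorem twist_twist_inv (g : signedPerm n) (u : FreeGroup (SignedIndex n)) :
    twist g (twist g⁻¹ u) = u := by rw [← twist_mul, mul_inv_cancel, twist_one]

/-- The parity of the length of a word. -/
def parity : FreeGroup (SignedIndex n) →* ℤˣ := FreeGroup.lift fun _ => -1

theorem parity_of (v : SignedIndex n) : parity (FreeGroup.of v) = -1 := by simp [parity]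

theorem parity_twist (g : signedPerm n) (u : FreeGroup (SignedIndex n)) :
    parity (twist g u) = parity u := by
  have : (parity (n := n)).comp (twist g) = parity := by
    ext v
    simp [twist_of, parity_of]
  exact DFunLike.congr_fun this u

theorem parity_inv (u : FreeGroup (SignedIndex n)) : parity u⁻¹ = parity u := by
  rw [map_inv, Int.units_inv_eq_self]

theorem prod_crossing (v : SignedIndex n) (z : SignedPoint n) :
    ∏ i, (crossing v z).1 i = -∏ i, z.1 i := by
  obtain ⟨j, s⟩ := v
  obtain ⟨x, p⟩ := z
  rw [crossing_apply]
  simp only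
  rw [Finset.prod_update_of_mem (Finset.mem_univ j),
    ← Finset.mul_prod_erase _ _ (Finset.mem_univ j), neg_mul, Finset.sdiff_singleton_eq_erase]

theorem prod_act (u : FreeGroup (SignedIndex n)) (z : SignedPoint n) :
    ∏ i, (act u z).1 i = parity u * ∏ i, z.1 i := by
  induction u using FreeGroup.induction_on generalizing z with
  | C1 => simp
  | of v => rw [act_of, prod_crossing, parity_of, neg_one_mul]
  | inv_of v ih =>
    rw [parity_inv, parity_of, map_inv, act_of, neg_one_mul]
    have h1 : (crossing v)⁻¹ = crossing v := inv_eq_of_mul_eq_one_left (crossing_mul_self v)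
    rw [h1, prod_crossing]
  | mul a b iha ihb =>
    rw [map_mul, Equiv.Perm.mul_apply, iha, ihb, map_mul, mul_assoc]

variable (n) in
/-- The words all of whose images under even signed permutations fix the even points, and all of
whose images under odd signed permutations fix the odd points. Its cosets are the vertices of the
polytope. -/
def vertexSubgroup : Subgroup (FreeGroup (SignedIndex n)) where
  carrier := {u | ∀ (g : signedPerm n) (z : SignedPoint n), ∏ i, z.1 i = signedPerm.sign g →
    act (twist g u) z = z}
  one_mem' := by simp
  mul_mem' := by
    intro u w hu hw g z hz
    rw [map_mul, map_mul, Equiv.Perm.mul_apply, hw g z hz, hu g z hz]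
  inv_mem' := by
    intro u hu g z hz
    rw [map_inv, map_inv, Equiv.Perm.inv_eq_iff_eq, hu g z hz]

theorem parity_eq_one {u : FreeGroup (SignedIndex n)} (hu : u ∈ vertexSubgroup n) :
    parity u = 1 := by
  have h1 := prod_act (twist 1 u) (1, 0)
  rw [hu 1 (1, 0) (by simp [signedPerm.sign_one]), parity_twist] at h1
  simpa using h1.symm

/-- The subgroup is normalized by the pairs of a word and a signed permutation of equal
parities. -/
theorem conj_twist_mem {u h : FreeGroup (SignedIndex n)} {g : signedPerm n}
    (hu : u ∈ vertexSubgroup n) (hgh : parity h = signedPerm.sign g) :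
    h⁻¹ * twist g u * h ∈ vertexSubgroup n := by
  intro g' z hz
  have h1 : act (twist g' (twist g u)) (act (twist g' h) z) = act (twist g' h) z := by
    rw [← twist_mul]
    refine hu _ _ ?_
    rw [prod_act, parity_twist, hgh, hz, signedPerm.sign_mul, mul_comm]
  rw [map_mul, map_mul, map_mul, map_mul, Equiv.Perm.mul_apply, Equiv.Perm.mul_apply, h1, map_inv,
    map_inv]
  exact Equiv.symm_apply_apply _ _

theorem conj_sq_mem (u : FreeGroup (SignedIndex n)) (v : SignedIndex n) :
    u⁻¹ * (FreeGroup.of v * FreeGroup.of v * u) ∈ vertexSubgroup n := by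
  intro g z _
  simp only [map_mul, map_inv, twist_of, act_of, crossing_mul_self, one_mul, inv_mul_cancel,
    Equiv.Perm.one_apply]

instance : (vertexSubgroup n).FiniteIndex := by
  let φ : FreeGroup (SignedIndex n) →* (signedPerm n → Equiv.Perm (SignedPoint n)) :=
    MonoidHom.pi fun g => act.comp (twist g)
  have hle : φ.ker ≤ vertexSubgroup n := fun u hu g z _ => by
    have h1 : act (twist g u) = 1 := congrFun hu g
    rw [h1, Equiv.Perm.one_apply]
  exact Subgroup.finiteIndex_of_le hle

variable (n) in
/-- The vertex set of the polytope. -/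
abbrev VertexSet := FreeGroup (SignedIndex n) ⧸ vertexSubgroup n

/-- The involutions on the vertex set. -/
def edgeMap (v : SignedIndex n) (x : VertexSet n) : VertexSet n := FreeGroup.of v • x

theorem edgeMap_mk (v : SignedIndex n) (u : FreeGroup (SignedIndex n)) :
    edgeMap v (u : VertexSet n) = ((FreeGroup.of v * u : FreeGroup _) : VertexSet n) := rfl

theorem edgeMap_edgeMap (v : SignedIndex n) (x : VertexSet n) : edgeMap v (edgeMap v x) = x := by
  induction x using QuotientGroup.induction_on with
  | H u =>
    rw [edgeMap_mk, edgeMap_mk]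
    refine (QuotientGroup.eq.2 ?_).symm
    rw [← mul_assoc (FreeGroup.of v)]
    exact conj_sq_mem u v

/-- The parity of a vertex. -/
def vertexParity : VertexSet n → ℤˣ :=
  Quotient.lift parity fun u w huw => by
    have h1 := parity_eq_one (QuotientGroup.leftRel_apply.1 huw)
    rw [map_mul, parity_inv] at h1
    rw [eq_inv_of_mul_eq_one_left h1, Int.units_inv_eq_self]

theorem vertexParity_mk (u : FreeGroup (SignedIndex n)) :
    vertexParity (u : VertexSet n) = parity u := rfl

theorem vertexParity_edgeMap (v : SignedIndex n) (x : VertexSet n) :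
    vertexParity (edgeMap v x) = -vertexParity x := by
  induction x using QuotientGroup.induction_on with
  | H u => rw [edgeMap_mk, vertexParity_mk, vertexParity_mk, map_mul, parity_of, neg_one_mul]

theorem smul_mem_orb (u : FreeGroup (SignedIndex n)) (x : VertexSet n) :
    u • x ∈ orb edgeMap Finset.univ x := by
  induction u using FreeGroup.induction_on generalizing x with
  | C1 => rw [one_smul]; exact mem_orb_self _ _ _
  | of v => exact apply_mem_orb _ (Finset.mem_univ v) x
  | inv_of v ih =>
    have h1 : (FreeGroup.of v)⁻¹ • x = edgeMap v x := by
      rw [inv_smul_eq_iff]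
      exact (edgeMap_edgeMap v x).symm
    rw [h1]
    exact apply_mem_orb _ (Finset.mem_univ v) x
  | mul a b iha ihb =>
    rw [mul_smul]
    exact orb_trans _ (ihb x) (iha _)

theorem isEdgeSystem : IsEdgeSystem (edgeMap (n := n)) where
  nonempty := ⟨((1 : FreeGroup (SignedIndex n)) : VertexSet n)⟩
  involutive := edgeMap_edgeMap
  ne_self v x hx := by
    have h1 := vertexParity_edgeMap v x
    rw [hx] at h1
    rcases Int.units_eq_one_or (vertexParity x) with e | e <;> rw [e] at h1 <;>
      exact absurd h1 (by decide)
  transitive x y := by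
    induction x using QuotientGroup.induction_on with
    | H u =>
      induction y using QuotientGroup.induction_on with
      | H w =>
        have h1 := smul_mem_orb (w * u⁻¹) (u : VertexSet n)
        have h2 : (w * u⁻¹) • (u : VertexSet n) = (w : VertexSet n) := by
          rw [MulAction.Quotient.smul_coe, smul_eq_mul, inv_mul_cancel_right]
        rwa [h2] at h1

end VertexSet

/-! ### Chirality -/

section Chirality

variable {n : ℕ}

theorem act_twist_chiralWord (hn : 2 ≤ n) (g : signedPerm n) :
    act (twist g (chiralWord hn FreeGroup.of)) = chiralWord hn fun v => crossing (g.1 v) := by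
  rw [map_chiralWord, map_chiralWord]
  simp only [twist_of, act_of]

theorem chiralWord_mem (hn : 2 ≤ n) : chiralWord hn FreeGroup.of ∈ vertexSubgroup n := by
  rintro g ⟨x, p⟩ hz
  rw [act_twist_chiralWord, isAffineAt_chiralWord hn (isAffineAt_pairProd g x) p]
  have h1 : ∏ i, (g.1 (i, 1)).2 * x (g.1 (i, 1)).1 = 1 := by
    rw [Finset.prod_mul_distrib, signedPerm.prod_comp g x]
    simp only at hz
    rw [hz]
    exact Int.units_mul_self _
  rw [h1]
  simp

/-- The chirality word moves an odd point. -/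
theorem exists_chiralWord_ne (hn : 2 ≤ n) :
    ∃ z : SignedPoint n, ∏ i, z.1 i = -1 ∧ act (chiralWord hn FreeGroup.of) z ≠ z := by
  let i₀ : Fin n := ⟨0, by omega⟩
  let i₁ : Fin n := ⟨1, by omega⟩
  let x : Fin n → ℤˣ := Function.update 1 i₁ (-1)
  have hx : ∏ i, x i = -1 := by
    simp [x, Finset.prod_update_of_mem]
  have hx0 : x i₀ = 1 := by simp [x, i₀, i₁]
  have hx1 : x i₁ = -1 := by simp [x]
  refine ⟨(x, 0), hx, ?_⟩
  have h1 := isAffineAt_chiralWord hn (isAffineAt_pairProd 1 x) 0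
  rw [← act_twist_chiralWord, twist_one] at h1
  rw [h1]
  simp only [OneMemClass.coe_one, Equiv.Perm.one_apply, one_mul]
  rw [hx]
  change ¬ (x, 1 * 0 + _ * (_ * shift i₀ * (1 - lin (x i₁)) -
    _ * shift i₁ * (1 - lin (x i₀)))) = (x, (0 : ZMod 11))
  rw [hx0, hx1]
  intro h2
  have h3 := congrArg Prod.snd h2
  simp [shift, lin, i₀, i₁] at h3
  -- the remaining value is `-2 * (3 * (1 - 3)) = 12`, which is not zero modulo `11`
  revert h3
  decide

end Chirality

/-! ### Automorphisms of the flag graph -/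

section Automorphisms

variable {n : ℕ}

open signedPerm FacePoset

/-- The map `u ↦ g u * h` on the vertices. -/
def vertexMap (g : signedPerm n) (h : FreeGroup (SignedIndex n)) (hgh : parity h = sign g) :
    VertexSet n → VertexSet n :=
  Quotient.map (fun u => twist g u * h) fun u w huw => by
    rw [← Quotient.eq_iff_equiv] at huw ⊢
    have huw' : u⁻¹ * w ∈ vertexSubgroup n := QuotientGroup.eq.1 huw
    refine QuotientGroup.eq.2 ?_
    have := conj_twist_mem huw' hgh
    rwa [map_mul, map_inv, mul_assoc, mul_assoc, ← mul_assoc, ← mul_inv_rev] at this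

theorem vertexMap_mk {g : signedPerm n} {h : FreeGroup (SignedIndex n)} (hgh : parity h = sign g)
    (u : FreeGroup (SignedIndex n)) :
    vertexMap g h hgh (u : VertexSet n) = ((twist g u * h : FreeGroup _) : VertexSet n) := rfl

theorem vertexMap_edgeMap {g : signedPerm n} {h : FreeGroup (SignedIndex n)}
    (hgh : parity h = sign g) (v : SignedIndex n) (x : VertexSet n) :
    vertexMap g h hgh (edgeMap v x) = edgeMap (g.1 v) (vertexMap g h hgh x) := by
  induction x using QuotientGroup.induction_on with
  | H u => rw [edgeMap_mk, vertexMap_mk, vertexMap_mk, edgeMap_mk, map_mul, twist_of, mul_assoc]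

theorem vertexMap_bijective {g : signedPerm n} {h : FreeGroup (SignedIndex n)}
    (hgh : parity h = sign g) : Function.Bijective (vertexMap g h hgh) := by
  refine Finite.surjective_iff_bijective.1 fun x => ?_
  induction x using QuotientGroup.induction_on with
  | H w =>
    refine ⟨((twist g⁻¹ (w * h⁻¹) : FreeGroup _) : VertexSet n), ?_⟩
    rw [vertexMap_mk, twist_twist_inv, inv_mul_cancel_right]

/-- The automorphism of the flag graph given by a signed permutation and a word of equal
parities. -/
noncomputable def flagAut (hn : 0 < n) {g : signedPerm n} {h : FreeGroup (SignedIndex n)}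
    (hgh : parity h = sign g) :
    ColoredGraph.Iso (flagGraph (FacePoset (edgeMap (n := n))) (n + 1))
      (flagGraph (FacePoset (edgeMap (n := n))) (n + 1)) where
  toEquiv := (flagEquiv isEdgeSystem).symm.trans
    (((Equiv.ofBijective _ (vertexMap_bijective hgh)).prodCongr (Equiv.mulLeft g)).trans
      (flagEquiv isEdgeSystem))
  adj_iff := by
    intro i Φ Ψ
    obtain ⟨p, rfl⟩ := (flagEquiv isEdgeSystem).surjective Φ
    obtain ⟨q, rfl⟩ := (flagEquiv isEdgeSystem).surjective Ψ
    set e := (Equiv.ofBijective _ (vertexMap_bijective hgh)).prodCongr (Equiv.mulLeft g) with he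
    simp only [Equiv.trans_apply, Equiv.symm_apply_apply]
    have hi : (i : ℕ) ≤ n := Nat.lt_succ_iff.1 i.2
    refine (adjacent_flagOf_iff hn isEdgeSystem hi (e p) (e q)).trans
      (Iff.trans ?_ (adjacent_flagOf_iff hn isEdgeSystem hi p q).symm)
    have hcomm : nbr edgeMap hn i (e p) = e (nbr edgeMap hn i p) := by
      by_cases h0 : (i : ℕ) = 0
      · rw [h0, nbr_zero, nbr_zero]
        exact Prod.ext (vertexMap_edgeMap hgh _ _).symm rfl
      · rw [nbr_of_ne_zero hn h0, nbr_of_ne_zero hn h0]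
        exact Prod.ext rfl (mul_assoc _ _ _)
    rw [hcomm, e.apply_eq_iff_eq]

theorem flagAut_apply (hn : 0 < n) {g : signedPerm n} {h : FreeGroup (SignedIndex n)}
    (hgh : parity h = sign g) (u : FreeGroup (SignedIndex n)) (a : signedPerm n) :
    (flagAut hn hgh).toEquiv (flagOf isEdgeSystem ((u : VertexSet n), a)) =
      flagOf isEdgeSystem (((twist g u * h : FreeGroup _) : VertexSet n), g * a) := by
  change flagEquiv isEdgeSystem _ = _
  have h1 : (flagEquiv isEdgeSystem).symm (flagOf isEdgeSystem ((u : VertexSet n), a)) =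
      ((u : VertexSet n), a) := (flagEquiv isEdgeSystem).symm_apply_apply _
  simp only [h1]
  rfl

/-- The invariant that distinguishes the two flag orbits. -/
def flagType (p : VertexSet n × signedPerm n) : ℤˣ := vertexParity p.1 * sign p.2

theorem flagType_nbr_of_link (hn : 0 < n) {i : ℕ} (hi : i = 0 ∨ i = n)
    (p : VertexSet n × signedPerm n) : flagType (nbr edgeMap hn i p) = -flagType p := by
  unfold flagType
  rcases hi with rfl | rfl
  · rw [nbr_zero]
    simp only
    rw [vertexParity_edgeMap, neg_mul]
  · rw [nbr_of_ne_zero hn hn.ne']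
    simp only
    rw [sign_mul, sign_gen_self hn, mul_neg_one, mul_neg]

theorem flagType_nbr_of_semiedge (hn : 0 < n) {i : ℕ} (h1 : 1 ≤ i) (h2 : i < n)
    (p : VertexSet n × signedPerm n) : flagType (nbr edgeMap hn i p) = flagType p := by
  unfold flagType
  rw [nbr_of_ne_zero hn (by omega)]
  simp only
  rw [sign_mul, sign_gen_of_lt h1 h2, mul_one]

/-- An automorphism of the flag graph is determined by the image of one flag, so that it extends the
action of a signed permutation on labels. -/
theorem aut_apply (hn : 0 < n)
    (σ : ColoredGraph.Iso (flagGraph (FacePoset (edgeMap (n := n))) (n + 1))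
      (flagGraph (FacePoset (edgeMap (n := n))) (n + 1))) {g a : signedPerm n} {x y : VertexSet n}
    (hσ : σ.toEquiv (flagOf isEdgeSystem (x, a)) = flagOf isEdgeSystem (y, g * a))
    (u : FreeGroup (SignedIndex n)) (b : signedPerm n) :
    σ.toEquiv (flagOf isEdgeSystem (u • x, b)) =
      flagOf isEdgeSystem (twist g u • y, g * b) := by
  have hnbr : ∀ i ≤ n, ∀ p q, σ.toEquiv (flagOf isEdgeSystem p) = flagOf isEdgeSystem q →
      σ.toEquiv (flagOf isEdgeSystem (nbr edgeMap hn i p)) =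
        flagOf isEdgeSystem (nbr edgeMap hn i q) := by
    intro i hi p q hpq
    obtain ⟨r, hr⟩ := flagOf_surjective isEdgeSystem
      (σ.toEquiv (flagOf isEdgeSystem (nbr edgeMap hn i p)))
    have h1 : Flag.Adjacent i (σ.toEquiv (flagOf isEdgeSystem p))
        (σ.toEquiv (flagOf isEdgeSystem (nbr edgeMap hn i p))) :=
      (σ.adj_iff ⟨i, Nat.lt_succ_iff.2 hi⟩ _ _).2 (adjacent_nbr hn isEdgeSystem hi p)
    rw [hpq, ← hr, adjacent_flagOf_iff hn isEdgeSystem hi] at h1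
    rw [← hr, h1]
  have hlabel : ∀ (z w : VertexSet n) (c d : signedPerm n),
      σ.toEquiv (flagOf isEdgeSystem (z, c)) = flagOf isEdgeSystem (w, g * c) →
      σ.toEquiv (flagOf isEdgeSystem (z, d)) = flagOf isEdgeSystem (w, g * d) := by
    intro z w c d hzw
    have hcd := reflTransGen_gen hn isEdgeSystem c d
    induction hcd with
    | refl => exact hzw
    | tail _ hstep ih =>
      obtain ⟨i, h1, h2, rfl⟩ := hstep
      have h3 := hnbr i h2 _ _ ih
      rw [nbr_of_ne_zero hn (by omega), nbr_of_ne_zero hn (by omega)] at h3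
      rwa [mul_assoc] at h3
  have hedge : ∀ (v : SignedIndex n) (z w : VertexSet n),
      (∀ c, σ.toEquiv (flagOf isEdgeSystem (z, c)) = flagOf isEdgeSystem (w, g * c)) →
      ∀ c, σ.toEquiv (flagOf isEdgeSystem (edgeMap v z, c)) =
        flagOf isEdgeSystem (edgeMap (g.1 v) w, g * c) := by
    intro v z w hzw c
    obtain ⟨i, s⟩ := v
    -- a signed permutation which maps the first basis vector to the given one
    let d : signedPerm n := swap ⟨0, hn⟩ i * (if s = 1 then 1 else flip ⟨0, hn⟩)
    have hd : d.1 (⟨0, hn⟩, 1) = (i, s) := by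
      rcases Int.units_eq_one_or s with rfl | rfl
      · simp [d, swap_apply]
      · have : (-1 : ℤˣ) ≠ 1 := by decide
        simp [d, swap_apply, flip_apply_one, this]
    have h3 := hnbr 0 (Nat.zero_le n) _ _ (hzw d)
    rw [nbr_zero, nbr_zero] at h3
    simp only [Subgroup.coe_mul, Equiv.Perm.mul_apply, hd] at h3
    exact hlabel _ _ d c h3
  have hall : ∀ (u : FreeGroup (SignedIndex n)) (z w : VertexSet n),
      (∀ c, σ.toEquiv (flagOf isEdgeSystem (z, c)) = flagOf isEdgeSystem (w, g * c)) →
      ∀ c, σ.toEquiv (flagOf isEdgeSystem (u • z, c)) =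
        flagOf isEdgeSystem (twist g u • w, g * c) := by
    intro u
    induction u using FreeGroup.induction_on with
    | C1 =>
      intro z w hzw
      rwa [map_one, one_smul, one_smul]
    | of v =>
      intro z w hzw
      rw [twist_of]
      exact hedge v z w hzw
    | inv_of v ih =>
      intro z w hzw
      have hv : ∀ (v : SignedIndex n) (z : VertexSet n), (FreeGroup.of v)⁻¹ • z = edgeMap v z :=
        fun v z => by
          rw [inv_smul_eq_iff]
          exact (edgeMap_edgeMap v z).symm
      rw [map_inv, twist_of, hv, hv]
      exact hedge v z w hzw
    | mul k l ihk ihl =>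
      intro z w hzw
      rw [map_mul, mul_smul, mul_smul]
      exact ihk _ _ (ihl _ _ hzw)
  exact hall u x y (fun c => hlabel x y a c hσ) b

/-- Two flags lie in the same orbit if and only if they have the same type. -/
theorem orbit_iff (hn : 2 ≤ n) (p q : VertexSet n × signedPerm n) :
    (flagGraph (FacePoset (edgeMap (n := n))) (n + 1)).orbitSetoid.r
      (flagOf isEdgeSystem p) (flagOf isEdgeSystem q) ↔ flagType p = flagType q := by
  obtain ⟨x, a⟩ := p
  obtain ⟨y, b⟩ := q
  induction x using QuotientGroup.induction_on with
  | H u =>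
    induction y using QuotientGroup.induction_on with
    | H w =>
      -- the only candidate for the pair that maps one flag to the other
      set g := b * a⁻¹ with hg
      set h := (twist g u)⁻¹ * w with hh
      have hga : g * a = b := inv_mul_cancel_right b a
      have hsg : sign g = sign b * sign a := by rw [hg, sign_mul, sign_inv]
      have hph : parity h = parity u * parity w := by
        rw [hh, map_mul, parity_inv, parity_twist]
      have htype : flagType ((u : VertexSet n), a) = flagType ((w : VertexSet n), b) ↔
          parity h = sign g := by
        rw [hsg, hph]
        change parity u * sign a = parity w * sign b ↔ _
        rcases Int.units_eq_one_or (parity u) with e1 | e1 <;>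
        rcases Int.units_eq_one_or (parity w) with e2 | e2 <;>
        rcases Int.units_eq_one_or (sign a) with e3 | e3 <;>
        rcases Int.units_eq_one_or (sign b) with e4 | e4 <;>
        rw [e1, e2, e3, e4] <;> decide
      rw [htype]
      constructor
      · rintro ⟨σ, hσ⟩
        by_contra hne
        rw [← hga] at hσ
        have haut := aut_apply (by omega) σ hσ
        -- the stabilizer of a vertex is mapped to the stabilizer of its image
        have hstab : ∀ m ∈ vertexSubgroup n, h⁻¹ * twist g m * h ∈ vertexSubgroup n := by
          intro m hm
          have h1 : (u * m * u⁻¹) • (u : VertexSet n) = (u : VertexSet n) := by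
            rw [MulAction.Quotient.smul_coe, smul_eq_mul, inv_mul_cancel_right]
            refine QuotientGroup.eq.2 ?_
            rw [mul_inv_rev, mul_assoc, inv_mul_cancel, mul_one]
            exact inv_mem hm
          have h2 := haut (u * m * u⁻¹) a
          rw [h1, hσ] at h2
          have h3 := congrArg Prod.fst (flagOf_injective _ h2)
          simp only [MulAction.Quotient.smul_coe, smul_eq_mul] at h3
          have h4 := QuotientGroup.eq.1 h3
          rw [hh]
          simp only [map_mul, map_inv] at h4 ⊢
          convert h4 using 1
          group
        obtain ⟨z, hz, hzne⟩ := exists_chiralWord_ne hn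
        have hmem := hstab _ (chiralWord_mem hn)
        have h1 := hmem g⁻¹ ((act (twist g⁻¹ h))⁻¹ z) (by
          rw [← map_inv, prod_act, parity_inv, parity_twist, hz, sign_inv]
          rcases Int.units_eq_one_or (parity h) with e1 | e1 <;>
          rcases Int.units_eq_one_or (sign g) with e2 | e2 <;>
          rw [e1, e2] at hne ⊢ <;> revert hne <;> decide)
        simp only [map_mul, map_inv, twist_inv_twist, Equiv.Perm.mul_apply] at h1
        have h2 : act (twist g⁻¹ h) ((act (twist g⁻¹ h))⁻¹ z) = z := Equiv.apply_symm_apply _ _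
        rw [h2] at h1
        exact hzne ((act (twist g⁻¹ h))⁻¹.injective h1)
      · intro hgh
        refine ⟨flagAut (by omega) hgh, ?_⟩
        rw [flagAut_apply, hga, hh, mul_inv_cancel_left]

end Automorphisms

open FacePoset in
/-- For `n ≥ 2` the premaniplex `2^{n+1}_{[1,n-1]}` of rank `n + 1` with two vertices, whose only
links have colours `0` and `n`, is the symmetry type graph of a (finite) abstract polytope. -/
theorem theorem5p6 (n : ℕ) (hn : 2 ≤ n) :
    ∃ (P : Type) (_ : PartialOrder P), Finite P ∧ IsAbstractPolytope P (n + 1) ∧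
      Nonempty (ColoredGraph.Iso (flagGraph P (n + 1)).symmetryTypeGraph
        (ColoredGraph.twoVertex (n + 1) {i : Fin (n + 1) | 1 ≤ (i : ℕ) ∧ (i : ℕ) ≤ n - 1})) := by
  have hn0 : 0 < n := by omega
  have hfin : Finite (FacePoset (edgeMap (n := n))) :=
    inferInstanceAs (Finite (Option (Option (ProperFace (edgeMap (n := n))))))
  refine ⟨FacePoset (edgeMap (n := n)), inferInstance, hfin, isAbstractPolytope hn0 isEdgeSystem,
    ⟨?_⟩⟩
  let G := flagGraph (FacePoset (edgeMap (n := n))) (n + 1)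
  let ty : Flag (FacePoset (edgeMap (n := n))) → ℤˣ :=
    fun Φ => flagType ((flagEquiv isEdgeSystem).symm Φ)
  have hty : ∀ p, ty (flagOf isEdgeSystem p) = flagType p := fun p =>
    congrArg flagType ((flagEquiv isEdgeSystem).symm_apply_apply p)
  have horb : ∀ Φ Ψ, Quotient.mk G.orbitSetoid Φ = Quotient.mk G.orbitSetoid Ψ ↔
      ty Φ = ty Ψ := by
    intro Φ Ψ
    obtain ⟨p, rfl⟩ := flagOf_surjective isEdgeSystem Φ
    obtain ⟨q, rfl⟩ := flagOf_surjective isEdgeSystem Ψ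
    rw [Quotient.eq, hty, hty]
    exact orbit_iff hn p q
  have hlink : ∀ (i : Fin (n + 1)) (p : VertexSet n × signedPerm n),
      i ∉ {i : Fin (n + 1) | 1 ≤ (i : ℕ) ∧ (i : ℕ) ≤ n - 1} →
      flagType (nbr edgeMap hn0 i p) = -flagType p := fun i p hi =>
    flagType_nbr_of_link hn0 (by rw [Set.mem_ofPred_eq] at hi; omega) p
  have hsemi : ∀ (i : Fin (n + 1)) (p : VertexSet n × signedPerm n),
      i ∈ {i : Fin (n + 1) | 1 ≤ (i : ℕ) ∧ (i : ℕ) ≤ n - 1} →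
      flagType (nbr edgeMap hn0 i p) = flagType p := fun i p hi =>
    flagType_nbr_of_semiedge hn0 hi.1 (by have := hi.2; omega) p
  let f : Quotient G.orbitSetoid → Bool :=
    Quotient.lift (fun Φ => decide (ty Φ = 1)) fun Φ Ψ h => by
      rw [(horb Φ Ψ).1 (Quotient.sound h)]
  have hf : ∀ Φ Ψ, f (Quotient.mk _ Φ) = f (Quotient.mk _ Ψ) ↔ ty Φ = ty Ψ := by
    intro Φ Ψ
    change decide (ty Φ = 1) = decide (ty Ψ = 1) ↔ _
    rcases Int.units_eq_one_or (ty Φ) with e1 | e1 <;>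
    rcases Int.units_eq_one_or (ty Ψ) with e2 | e2 <;> rw [e1, e2] <;> decide
  have hbij : Function.Bijective f := by
    constructor
    · intro A B
      induction A using Quotient.inductionOn
      induction B using Quotient.inductionOn
      rw [hf, horb]
      exact id
    · intro c
      let p : VertexSet n × signedPerm n := (QuotientGroup.mk 1, 1)
      let q := nbr edgeMap hn0 0 p
      have hpq : f (Quotient.mk _ (flagOf isEdgeSystem p)) ≠
          f (Quotient.mk _ (flagOf isEdgeSystem q)) := by
        rw [ne_eq, hf, hty, hty, flagType_nbr_of_link hn0 (Or.inl rfl)]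
        rcases Int.units_eq_one_or (flagType p) with e | e <;> rw [e] <;> decide
      by_cases hc : f (Quotient.mk _ (flagOf isEdgeSystem p)) = c
      · exact ⟨_, hc⟩
      · refine ⟨Quotient.mk _ (flagOf isEdgeSystem q), ?_⟩
        revert hpq hc
        generalize f (Quotient.mk _ (flagOf isEdgeSystem p)) = c₁
        generalize f (Quotient.mk _ (flagOf isEdgeSystem q)) = c₂
        revert c c₁ c₂
        decide
  refine ⟨Equiv.ofBijective f hbij, fun i A B => ?_⟩
  induction A using Quotient.inductionOn with | h Φ => ?_
  induction B using Quotient.inductionOn with | h Ψ => ?_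
  have hi : (i : ℕ) ≤ n := Nat.lt_succ_iff.1 i.2
  have hadj : (ColoredGraph.twoVertex (n + 1)
      {i : Fin (n + 1) | 1 ≤ (i : ℕ) ∧ (i : ℕ) ≤ n - 1}).Adj i (f (Quotient.mk _ Φ))
        (f (Quotient.mk _ Ψ)) ↔ ∃ p, flagOf isEdgeSystem p = Φ ∧
          ty Ψ = flagType (nbr edgeMap hn0 i p) := by
    obtain ⟨p, rfl⟩ := flagOf_surjective isEdgeSystem Φ
    have h1 : (∃ p', flagOf isEdgeSystem p' = flagOf isEdgeSystem p ∧
        ty Ψ = flagType (nbr edgeMap hn0 i p')) ↔ ty Ψ = flagType (nbr edgeMap hn0 i p) := by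
      constructor
      · rintro ⟨p', h1, h2⟩
        rwa [flagOf_injective _ h1] at h2
      · exact fun h => ⟨p, rfl, h⟩
    rw [h1]
    simp only [ColoredGraph.twoVertex]
    rw [ne_eq, hf, hty]
    by_cases hmem : i ∈ {i : Fin (n + 1) | 1 ≤ (i : ℕ) ∧ (i : ℕ) ≤ n - 1}
    · rw [hsemi i p hmem]
      simp only [hmem, true_and, not_true_eq_false, false_and, or_false]
      exact eq_comm
    · rw [hlink i p hmem]
      simp only [hmem, false_and, not_false_eq_true, true_and, false_or]
      rcases Int.units_eq_one_or (ty Ψ) with e1 | e1 <;>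
      rcases Int.units_eq_one_or (flagType p) with e2 | e2 <;> rw [e1, e2] <;> decide
  refine hadj.trans ⟨?_, ?_⟩
  · rintro ⟨p, rfl, h⟩
    refine ⟨_, flagOf isEdgeSystem (nbr edgeMap hn0 i p), rfl, (horb _ _).2 ?_,
      adjacent_nbr hn0 isEdgeSystem hi p⟩
    rw [hty, h]
  · rintro ⟨Φ', Ψ', h1, h2, h3⟩
    rw [horb] at h1 h2
    obtain ⟨p, rfl⟩ := flagOf_surjective isEdgeSystem Φ
    obtain ⟨p', rfl⟩ := flagOf_surjective isEdgeSystem Φ'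
    obtain ⟨q', rfl⟩ := flagOf_surjective isEdgeSystem Ψ'
    have h4 : q' = nbr edgeMap hn0 i p' := (adjacent_flagOf_iff hn0 isEdgeSystem hi p' q').1 h3
    refine ⟨p, rfl, ?_⟩
    rw [hty, hty] at h1
    rw [← h2, hty, h4]
    by_cases hmem : i ∈ {i : Fin (n + 1) | 1 ≤ (i : ℕ) ∧ (i : ℕ) ≤ n - 1}
    · rw [hsemi i _ hmem, hsemi i _ hmem, h1]
    · rw [hlink i _ hmem, hlink i _ hmem, h1]
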